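/- Let $J_n$ be the Bessel function of the first kind and $I_n,K_n$ the modified Bessel functions of the first and second kind. Let $a,n_0,\lambda,\varepsilon>0$ and $a<\min(D_h,D_v)$. For an index step $\delta$ and a number $\beta$ put $$\Lambda(\delta,\beta)=\sqrt{\tfrac{8\pi^2n_0\delta}{\lambda^2}-\tfrac{4\pi n_0\beta}{\lambda}},\qquad \Gamma(\beta)=\sqrt{\tfrac{4\pi n_0\beta}{\lambda}} .$$ Call $\beta$ a fundamental shift for $\delta$ if $\beta>0$, the first radicand is positive, $J_0$ has no zero on $[0,\Lambda a]$, and $\dfrac{\Lambda J_1(\Lambda a)}{J_0(\Lambda a)}=\dfrac{\Gamma K_1(\Gamma a)}{K_0(\Gamma a)}$, where $\Lambda=\Lambda(\delta,\beta)$, $\Gamma=\Gamma(\beta)$. Let $\beta_0,\beta_+,\beta_-$ be fundamental shifts for the index steps $\Delta n$, $\Delta n+\varepsilon$, $\Delta n-\varepsilon$, and let $(\Lambda,\Gamma)$, $(\Lambda_+,\Gamma_+)$, $(\Lambda_-,\Gamma_-)$ be the corresponding pairs. Put $$A=\Big[\pi a^2\big(J_1^2(\Lambda a)+J_0^2(\Lambda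 a)\big)+\pi a^2\Big(\tfrac{J_0(\Lambda a)}{K_0(\Gamma a)}\Big)^2\big(K_1^2(\Gamma a)-K_0^2(\Gamma a)\big)\Big]^{-1/2},\qquad B=A\,\frac{J_0(\Lambda a)}{K_0(\Gamma a)},$$ and define $A_\pm,B_\pm$ in the same way from $(\Lambda_\pm,\Gamma_\pm)$. The horizontal cores $i\in\{-25,\dots,25\}$ have centres $(iD_h,0)$ and the vertical cores $\pm$ have centres $(0,\pm D_v)$; all have radius $a$. With $r$ the distance to the centre, the mode $\varphi_i$ is $AJ_0(\Lambda r)$ for $r<a$ and $BK_0(\Gamma r)$ for $r\ge a$, and $\varphi_\pm$ is $A_\pm J_0(\Lambda_\pm r)$ for $r<a$ and $B_\pm K_0(\Gamma_\pm r)$ for $r\ge a$. Let $S_{\mu\nu}=\iint_{\mathbb R^2}\varphi_\mu\varphi_\nu\,dx\,dy$ for $\mu,\nu\in\{-25,\dots,25\}\cup\{+,-\}$. **Theorem.** All these integrals converge absolutely, $S_{\mu\nu}=S_{\nu\mu}$, the numbers $\Gamma,\Gamma_+,\Gamma_-$ have pairwise different squares, and the following hold. 1. $S_{ii}=1$ for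 every horizontal core $i$, and $S_{++}=S_{--}=1$. 2. For horizontal cores $i\ne j$ with $d=|i-j|D_h\ge 2a$ (that is, with disjoint cores), $$S_{ij}=\frac{4a\pi ABK_0(\Gamma d)}{\Gamma^2+\Lambda^2}\big[\Lambda I_0(\Gamma a)J_1(\Lambda a)+\Gamma J_0(\Lambda a)I_1(\Gamma a)\big]+\frac{\pi B^2dK_1(\Gamma d)}{\Gamma}-2\pi B^2a^2K_0(\Gamma d)\big[I_0(\Gamma a)K_0(\Gamma a)+I_1(\Gamma a)K_1(\Gamma a)\big].$$ 3. For a horizontal core $i$ with $d=\sqrt{(iD_h)^2+D_v^2}\ge 2a$ (disjoint cores), $$\begin{aligned}S_{i,+}={}&\frac{2\pi A_+BK_0(\Gamma d)\,a}{\Lambda_+^2+\Gamma^2}\big[\Lambda_+I_0(\Gamma a)J_1(\Lambda_+a)+\Gamma J_0(\Lambda_+a)I_1(\Gamma a)\big]\\&+\frac{2\pi AB_+K_0(\Gamma_+d)\,a}{\Lambda^2+\Gamma_+^2}\big[\Lambda I_0(\Gamma_+a)J_1(\Lambda a)+\Gamma_+J_0(\Lambda a)I_1(\Gamma_+a)\big]\\&+\frac{2\pi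 BB_+a}{\Gamma_+^2-\Gamma^2}\Big[K_0(\Gamma d)\big(\Gamma_+I_0(\Gamma a)K_1(\Gamma_+a)+\Gamma I_1(\Gamma a)K_0(\Gamma_+a)\big)\\&\qquad-K_0(\Gamma_+d)\big(\Gamma I_0(\Gamma_+a)K_1(\Gamma a)+\Gamma_+I_1(\Gamma_+a)K_0(\Gamma a)\big)\Big],\end{aligned}$$ $$\begin{aligned}S_{i,-}={}&\frac{2\pi A_-BK_0(\Gamma d)\,a}{\Lambda_-^2+\Gamma^2}\big[\Lambda_-I_0(\Gamma a)J_1(\Lambda_-a)+\Gamma J_0(\Lambda_-a)I_1(\Gamma a)\big]\\&+\frac{2\pi AB_-K_0(\Gamma_-d)\,a}{\Lambda^2+\Gamma_-^2}\big[\Lambda I_0(\Gamma_-a)J_1(\Lambda a)+\Gamma_-J_0(\Lambda a)I_1(\Gamma_-a)\big]\\&+\frac{2\pi BB_-a}{\Gamma^2-\Gamma_-^2}\Big[K_0(\Gamma_-d)\big(\Gamma I_0(\Gamma_-a)K_1(\Gamma a)+\Gamma_-I_1(\Gamma_-a)K_0(\Gamma a)\big)\\&\qquad-K_0(\Gamma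 d)\big(\Gamma_-I_0(\Gamma a)K_1(\Gamma_-a)+\Gamma I_1(\Gamma a)K_0(\Gamma_-a)\big)\Big].\end{aligned}$$ 4. For the two vertical cores, $$\begin{aligned}S_{+,-}={}&\frac{2\pi A_-B_+K_0(2\Gamma_+D_v)\,a}{\Lambda_-^2+\Gamma_+^2}\big[\Lambda_-I_0(\Gamma_+a)J_1(\Lambda_-a)+\Gamma_+J_0(\Lambda_-a)I_1(\Gamma_+a)\big]\\&+\frac{2\pi A_+B_-K_0(2\Gamma_-D_v)\,a}{\Lambda_+^2+\Gamma_-^2}\big[\Lambda_+I_0(\Gamma_-a)J_1(\Lambda_+a)+\Gamma_-J_0(\Lambda_+a)I_1(\Gamma_-a)\big]\\&+\frac{2\pi B_+B_-a}{\Gamma_+^2-\Gamma_-^2}\Big[K_0(2\Gamma_-D_v)\big(\Gamma_+I_0(\Gamma_-a)K_1(\Gamma_+a)+\Gamma_-I_1(\Gamma_-a)K_0(\Gamma_+a)\big)\\&\qquad-K_0(2\Gamma_+D_v)\big(\Gamma_-I_0(\Gamma_+a)K_1(\Gamma_-a)+\Gamma_+I_1(\Gamma_+a)K_0(\Gamma_-a)\big)\Big].\end{aligned}$$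 -/

import Mathlib

open MeasureTheory

noncomputable section

namespace WaveguideArray

/-! ### Bessel functions of integer order on the real line -/

/-- Bessel function of the first kind,
`J_n(x) = ∑_m (-1)^m / (m! (m+n)!) (x/2)^(2m+n)`. -/
def besselJ (n : ℕ) (x : ℝ) : ℝ :=
  ∑' m : ℕ, (-1) ^ m / ((m.factorial : ℝ) * ((m + n).factorial : ℝ)) * (x / 2) ^ (2 * m + n)

/-- Modified Bessel function of the first kind,
`I_n(x) = ∑_m 1 / (m! (m+n)!) (x/2)^(2m+n)`. -/
def besselI (n : ℕ) (x : ℝ) : ℝ :=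
  ∑' m : ℕ, 1 / ((m.factorial : ℝ) * ((m + n).factorial : ℝ)) * (x / 2) ^ (2 * m + n)

/-- Modified Bessel function of the second kind (used for `x > 0` only),
`K_n(x) = ∫_0^∞ exp(-x cosh t) cosh(n t) dt`. -/
def besselK (n : ℕ) (x : ℝ) : ℝ :=
  ∫ t in Set.Ioi (0 : ℝ), Real.exp (-(x * Real.cosh t)) * Real.cosh (n * t)

/-! ### A single step-index core

`a` is the radius of the core, `n₀` the background index, `lam` the wavelength,
`δ` the index step of the core and `β` the longitudinal wavenumber shift. -/

/-- Radicand of the transverse wavenumber inside the core. -/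
def lambdaSq (n₀ lam δ β : ℝ) : ℝ :=
  8 * Real.pi ^ 2 * n₀ * δ / lam ^ 2 - 4 * Real.pi * n₀ * β / lam

/-- Transverse wavenumber inside the core. -/
def coreLambda (n₀ lam δ β : ℝ) : ℝ := Real.sqrt (lambdaSq n₀ lam δ β)

/-- Transverse decay rate outside the core. -/
def coreGamma (n₀ lam β : ℝ) : ℝ := Real.sqrt (4 * Real.pi * n₀ * β / lam)

/-- Amplitude of the mode inside the core. -/
def ampA (a Λ Γ : ℝ) : ℝ :=
  (Real.pi * a ^ 2 * (besselJ 1 (Λ * a) ^ 2 + besselJ 0 (Λ * a) ^ 2)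
    + Real.pi * a ^ 2 * (besselJ 0 (Λ * a) / besselK 0 (Γ * a)) ^ 2
      * (besselK 1 (Γ * a) ^ 2 - besselK 0 (Γ * a) ^ 2)) ^ (-(1 / 2) : ℝ)

/-- Amplitude of the mode outside the core. -/
def ampB (a Λ Γ : ℝ) : ℝ := ampA a Λ Γ * (besselJ 0 (Λ * a) / besselK 0 (Γ * a))

/-- Euclidean distance between two points of the plane `ℝ × ℝ`
(whose Mathlib metric is the sup metric). -/
def euclDist (p c : ℝ × ℝ) : ℝ := Real.sqrt ((p.1 - c.1) ^ 2 + (p.2 - c.2) ^ 2)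

open Classical in
/-- Transverse mode of a core with centre `c`: `A J₀(Λ r)` in the open disc of radius `a`
around `c` and `B K₀(Γ r)` outside, `r` being the Euclidean distance to `c`. -/
def coreMode (a Λ Γ : ℝ) (c p : ℝ × ℝ) : ℝ :=
  if euclDist p c < a then ampA a Λ Γ * besselJ 0 (Λ * euclDist p c)
  else ampB a Λ Γ * besselK 0 (Γ * euclDist p c)

/-- `β` is the wavenumber shift of the fundamental guided mode of a core: both radicands are
positive, `Λ a` lies before the first zero of `J₀`, and the characteristic equation holds. -/
structure IsFundamentalShift (a n₀ lam δ β : ℝ) : Prop where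
  shift_pos : 0 < β
  lambdaSq_pos : 0 < lambdaSq n₀ lam δ β
  before_first_zero : ∀ x : ℝ, 0 ≤ x → x ≤ coreLambda n₀ lam δ β * a → besselJ 0 x ≠ 0
  char_eq :
    coreLambda n₀ lam δ β * besselJ 1 (coreLambda n₀ lam δ β * a)
        / besselJ 0 (coreLambda n₀ lam δ β * a)
      = coreGamma n₀ lam β * besselK 1 (coreGamma n₀ lam β * a)
        / besselK 0 (coreGamma n₀ lam β * a)

/-! ### The symmetry-broken array of 51 horizontal and 2 vertical cores -/

/-- Labels of the 53 waveguides: `-25, …, 25`, `+` and `-`. -/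
inductive Waveguide : Type
  | horiz (m : Set.Icc (-25 : ℤ) 25)
  | plus
  | minus

/-- Numerical data of the array. -/
structure Params where
  /-- core radius -/
  a : ℝ
  /-- horizontal spacing -/
  Dh : ℝ
  /-- vertical spacing -/
  Dv : ℝ
  /-- background refractive index -/
  n₀ : ℝ
  /-- index step of the horizontal cores -/
  Δn : ℝ
  /-- symmetry-breaking perturbation of the index step -/
  ε : ℝ
  /-- wavelength -/
  lam : ℝ
  /-- wavenumber shift of the horizontal cores -/
  β : ℝ
  /-- wavenumber shift of the upper core -/
  βp : ℝ
  /-- wavenumber shift of the lower core -/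
  βm : ℝ

namespace Params

/-- Standing assumptions: positivity, radius smaller than both spacings, and each wavenumber
shift belongs to the fundamental mode of its core, the index steps being `Δn` (horizontal),
`Δn + ε` (upper) and `Δn - ε` (lower). -/
structure Admissible (P : Params) : Prop where
  a_pos : 0 < P.a
  a_lt_Dh : P.a < P.Dh
  a_lt_Dv : P.a < P.Dv
  n₀_pos : 0 < P.n₀
  ε_pos : 0 < P.ε
  lam_pos : 0 < P.lam
  fund : IsFundamentalShift P.a P.n₀ P.lam P.Δn P.β
  fund_plus : IsFundamentalShift P.a P.n₀ P.lam (P.Δn + P.ε) P.βp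
  fund_minus : IsFundamentalShift P.a P.n₀ P.lam (P.Δn - P.ε) P.βm

/-- `Λ` -/
def Λ (P : Params) : ℝ := coreLambda P.n₀ P.lam P.Δn P.β
/-- `Γ` -/
def Γ (P : Params) : ℝ := coreGamma P.n₀ P.lam P.β
/-- `Λ_+` -/
def Λp (P : Params) : ℝ := coreLambda P.n₀ P.lam (P.Δn + P.ε) P.βp
/-- `Γ_+` -/
def Γp (P : Params) : ℝ := coreGamma P.n₀ P.lam P.βp
/-- `Λ_-` -/
def Λm (P : Params) : ℝ := coreLambda P.n₀ P.lam (P.Δn - P.ε) P.βm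
/-- `Γ_-` -/
def Γm (P : Params) : ℝ := coreGamma P.n₀ P.lam P.βm

/-- `A` -/
def A (P : Params) : ℝ := ampA P.a P.Λ P.Γ
/-- `B` -/
def B (P : Params) : ℝ := ampB P.a P.Λ P.Γ
/-- `A_+` -/
def Ap (P : Params) : ℝ := ampA P.a P.Λp P.Γp
/-- `B_+` -/
def Bp (P : Params) : ℝ := ampB P.a P.Λp P.Γp
/-- `A_-` -/
def Am (P : Params) : ℝ := ampA P.a P.Λm P.Γm
/-- `B_-` -/
def Bm (P : Params) : ℝ := ampB P.a P.Λm P.Γm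

/-- The mode of each waveguide. -/
def mode (P : Params) : Waveguide → ℝ × ℝ → ℝ
  | .horiz m => coreMode P.a P.Λ P.Γ ((m : ℤ) * P.Dh, 0)
  | .plus => coreMode P.a P.Λp P.Γp (0, P.Dv)
  | .minus => coreMode P.a P.Λm P.Γm (0, -P.Dv)

/-- The overlap matrix `S_{ij} = ∬ φ_i φ_j dx dy`. -/
def S (P : Params) : Matrix Waveguide Waveguide ℝ :=
  Matrix.of fun i j => ∫ p : ℝ × ℝ, P.mode i p * P.mode j p

end Params

end WaveguideArray

end

/-! Outside its core every mode is a multiple of `K₀(Γ|p - c|)`, a decaying solution of `Δu = Γ²u`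
away from `c`. For two disjoint cores, write `φ₂ = B₂ K₀(Γ₂|p - c₂|) + h₂`, where the defect `h₂`
vanishes outside the second core. On that core `φ₁` is already `B₁ K₀(Γ₁|p - c₁|)`, so the overlap
is a sum of two integrals, each of a function radial about one centre against a `K₀` centred at the
other (`integral_coreProfile_mul_coreProfile`).

Such an integral becomes one-dimensional in polar coordinates, because the circular mean of `K₀` is
explicit: it is `I₀(Γ r) K₀(Γ d)` for `r < d`, with `r` and `d` exchanged for `r > d`
(`circleIntegralK_eq`). The circular mean solves the modified Bessel equation in `r` and is regular
at the centre, hence is a multiple of `I₀`.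

The remaining integrals of `r u v` are of Lommel type. If `u`, `v` solve radial equations with
different spectral parameters, the integrand is, up to a constant, the derivative of the Wronskian
of `u` and `v` times `r`; if the parameters agree, a quadratic energy replaces the Wronskian. The
boundary terms at `r = d` collapse because `r` times the Wronskian of `K₀(Γ r)` and `I₀(Γ r)` is
identically `1` (`wronskianKI_self`). The endpoints `0` and `∞` require only the limits of `K₀` and
`K₁` there.

The diagonal entries are the same energy integrals, and the amplitude is exactly the normalising
constant. The denominators `Γ₂² - Γ₁²` are nonzero because `x J₁(x)/J₀(x)` is strictly increasing
before the first zero of `J₀`, so different index steps cannot share a decay rate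
(`coreGamma_sq_ne`). -/

namespace WaveguideArray

open Set Filter Topology

/-! ### Bessel functions defined by power series -/

/-- Power series with coefficients dominated by `C / m!` may be differentiated termwise. -/
theorem hasDerivAt_tsum_pow_succ {b : ℕ → ℝ}
    (hb : ∀ m : ℕ, |((m : ℝ) + 1) * b m| ≤ 1 / (m.factorial : ℝ)) (y : ℝ) :
    HasDerivAt (fun y : ℝ => ∑' m : ℕ, b m * y ^ (m + 1))
      (∑' m : ℕ, ((m : ℝ) + 1) * b m * y ^ m) y := by
  -- The radius `|y| + 1` makes the interval contain both `y` and the base point `0`, where the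
  -- series trivially converges.
  have hy : y ∈ Ioo (-(|y| + 1)) (|y| + 1) := by
    constructor <;> cases abs_cases y <;> linarith
  refine hasDerivAt_tsum_of_isPreconnected (u := fun m : ℕ => (|y| + 1) ^ m / (m.factorial : ℝ))
    (t := Ioo (-(|y| + 1)) (|y| + 1)) (y₀ := 0)
    (g' := fun (m : ℕ) (y : ℝ) => ((m : ℝ) + 1) * b m * y ^ m)
    (Real.summable_pow_div_factorial _) isOpen_Ioo isPreconnected_Ioo ?_ ?_ ?_ ?_ hy
  · intro m z _
    refine ((hasDerivAt_pow (m + 1) z).const_mul (b m)).congr_deriv ?_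
    push_cast [Nat.add_sub_cancel]
    ring
  · intro m z hz
    rw [norm_mul, norm_pow, Real.norm_eq_abs, Real.norm_eq_abs, div_eq_inv_mul]
    have hz' : |z| ≤ |y| + 1 := abs_le.2 ⟨hz.1.le, hz.2.le⟩
    have := hb m
    rw [one_div] at this
    gcongr
  · constructor <;> linarith [abs_nonneg y]
  · simp

theorem summable_mul_pow_of_abs_le {c : ℕ → ℝ} (hc : ∀ m : ℕ, |c m| ≤ 1 / (m.factorial : ℝ))
    (y : ℝ) : Summable fun m : ℕ => c m * y ^ m := by
  refine Summable.of_norm_bounded (Real.summable_pow_div_factorial |y|) fun m => ?_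
  rw [norm_mul, norm_pow, Real.norm_eq_abs, Real.norm_eq_abs, div_eq_inv_mul]
  have := hc m
  rw [one_div] at this
  gcongr

/-- The entire function `∑ s^m y^m / (m! (m+n)!)`. -/
noncomputable def besselSeries (s : ℝ) (n : ℕ) (y : ℝ) : ℝ :=
  ∑' m : ℕ, s ^ m / ((m.factorial : ℝ) * ((m + n).factorial : ℝ)) * y ^ m

theorem abs_besselSeries_coeff_le {s : ℝ} (hs : |s| = 1) (k m n : ℕ) :
    |s ^ k / ((m.factorial : ℝ) * (n.factorial : ℝ))| ≤ 1 / (m.factorial : ℝ) := by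
  have hm : (0 : ℝ) < m.factorial := by positivity
  have hn : (1 : ℝ) ≤ n.factorial := by exact_mod_cast Nat.succ_le_of_lt n.factorial_pos
  rw [abs_div, abs_pow, hs, one_pow, abs_of_pos (by positivity)]
  gcongr
  nlinarith

theorem continuous_besselSeries {s : ℝ} (hs : |s| = 1) (n : ℕ) : Continuous (besselSeries s n) := by
  refine continuous_iff_continuousAt.2 fun y => ?_
  have hy : Metric.closedBall (0 : ℝ) (|y| + 1) ∈ 𝓝 y := by
    refine mem_of_superset (Metric.isOpen_ball.mem_nhds ?_) Metric.ball_subset_closedBall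
    simp
  refine ContinuousOn.continuousAt ?_ hy
  refine continuousOn_tsum (u := fun m : ℕ => (|y| + 1) ^ m / (m.factorial : ℝ))
    (fun m => by fun_prop) (Real.summable_pow_div_factorial _) fun m z hz => ?_
  have hz' : |z| ≤ |y| + 1 := by simpa using hz
  have := abs_besselSeries_coeff_le hs m m (m + n)
  rw [one_div] at this
  rw [norm_mul, norm_pow, Real.norm_eq_abs, Real.norm_eq_abs, div_eq_inv_mul ((|y| + 1) ^ m)]
  exact mul_le_mul this (pow_le_pow_left₀ (abs_nonneg z) hz' m) (by positivity) (by positivity)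

/-- In the variable `y = (x/2)²` the Bessel recurrences are two first-order relations between power
series. The sign `s` treats `J` (`s = -1`) and `I` (`s = 1`) together. -/
theorem hasDerivAt_besselSeries_zero {s : ℝ} (hs : |s| = 1) (y : ℝ) :
    HasDerivAt (besselSeries s 0) (s * besselSeries s 1 y) y := by
  have key : ∀ m : ℕ, ((m : ℝ) + 1) * (s ^ (m + 1) / (((m + 1).factorial : ℝ) *
      ((m + 1).factorial : ℝ))) = s ^ (m + 1) / ((m.factorial : ℝ) * ((m + 1).factorial : ℝ)) := by
    intro m
    have : (m.factorial : ℝ) ≠ 0 := by positivity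
    have h2 : (m : ℝ) + 1 ≠ 0 := by positivity
    rw [Nat.factorial_succ]; push_cast; field_simp
  have h := hasDerivAt_tsum_pow_succ
    (b := fun m => s ^ (m + 1) / (((m + 1).factorial : ℝ) * ((m + 1).factorial : ℝ)))
    (fun m => by rw [key]; exact abs_besselSeries_coeff_le hs _ _ _) y
  have h2 : besselSeries s 0 = fun y => 1 + ∑' m : ℕ,
      s ^ (m + 1) / (((m + 1).factorial : ℝ) * ((m + 1).factorial : ℝ)) * y ^ (m + 1) := by
    funext z
    rw [besselSeries, (summable_mul_pow_of_abs_le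
      (fun m => abs_besselSeries_coeff_le hs m m (m + 0)) z).tsum_eq_zero_add]
    simp
  rw [h2]
  refine (h.const_add 1).congr_deriv ?_
  unfold besselSeries
  rw [← tsum_mul_left]
  refine tsum_congr fun m => ?_
  rw [key, pow_succ]; ring

theorem hasDerivAt_mul_besselSeries_one {s : ℝ} (hs : |s| = 1) (y : ℝ) :
    HasDerivAt (fun y => y * besselSeries s 1 y) (besselSeries s 0 y) y := by
  have key : ∀ m : ℕ, ((m : ℝ) + 1) * (s ^ m / ((m.factorial : ℝ) *
      ((m + 1).factorial : ℝ))) = s ^ m / ((m.factorial : ℝ) * (m.factorial : ℝ)) := by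
    intro m
    have : (m.factorial : ℝ) ≠ 0 := by positivity
    have h2 : (m : ℝ) + 1 ≠ 0 := by positivity
    rw [Nat.factorial_succ]; push_cast; field_simp
  have h := hasDerivAt_tsum_pow_succ
    (b := fun m => s ^ m / ((m.factorial : ℝ) * ((m + 1).factorial : ℝ)))
    (fun m => by rw [key]; exact abs_besselSeries_coeff_le hs _ _ _) y
  have h2 : (fun y => y * besselSeries s 1 y) = fun y => ∑' m : ℕ,
      s ^ m / ((m.factorial : ℝ) * ((m + 1).factorial : ℝ)) * y ^ (m + 1) := by
    funext z
    rw [besselSeries, ← tsum_mul_left]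
    refine tsum_congr fun m => ?_
    rw [pow_succ]; ring
  rw [h2]
  refine h.congr_deriv ?_
  unfold besselSeries
  refine tsum_congr fun m => ?_
  rw [key, add_zero]

theorem besselJ_zero_eq (x : ℝ) : besselJ 0 x = besselSeries (-1) 0 ((x / 2) ^ 2) := by
  simp [besselJ, besselSeries, pow_mul]

theorem besselI_zero_eq (x : ℝ) : besselI 0 x = besselSeries 1 0 ((x / 2) ^ 2) := by
  simp [besselI, besselSeries, pow_mul]

theorem besselJ_one_eq (x : ℝ) : besselJ 1 x = x / 2 * besselSeries (-1) 1 ((x / 2) ^ 2) := by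
  rw [besselJ, besselSeries, ← tsum_mul_left]
  refine tsum_congr fun m => ?_
  rw [pow_succ, pow_mul]; ring

theorem besselI_one_eq (x : ℝ) : besselI 1 x = x / 2 * besselSeries 1 1 ((x / 2) ^ 2) := by
  rw [besselI, besselSeries, ← tsum_mul_left]
  refine tsum_congr fun m => ?_
  rw [pow_succ, pow_mul, one_pow]; ring

theorem hasDerivAt_half_sq (x : ℝ) : HasDerivAt (fun x : ℝ => (x / 2) ^ 2) (x / 2) x := by
  refine (((hasDerivAt_id x).div_const 2).fun_pow 2).congr_deriv ?_
  simp
  ring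

theorem hasDerivAt_besselJ_zero (x : ℝ) : HasDerivAt (besselJ 0) (-besselJ 1 x) x := by
  have h := (hasDerivAt_besselSeries_zero (s := -1) (by simp) _).comp x (hasDerivAt_half_sq x)
  rw [show besselJ 0 = _ from funext besselJ_zero_eq, besselJ_one_eq]
  exact h.congr_deriv (by ring)

theorem hasDerivAt_besselI_zero (x : ℝ) : HasDerivAt (besselI 0) (besselI 1 x) x := by
  have h := (hasDerivAt_besselSeries_zero (s := 1) (by simp) _).comp x (hasDerivAt_half_sq x)
  rw [show besselI 0 = _ from funext besselI_zero_eq, besselI_one_eq]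
  exact h.congr_deriv (by ring)

theorem hasDerivAt_mul_besselJ_one (x : ℝ) :
    HasDerivAt (fun x => x * besselJ 1 x) (x * besselJ 0 x) x := by
  have h := ((hasDerivAt_mul_besselSeries_one (s := -1) (by simp) _).comp x
    (hasDerivAt_half_sq x)).const_mul 2
  have h2 : (fun x => x * besselJ 1 x) =
      fun x => 2 * ((x / 2) ^ 2 * besselSeries (-1) 1 ((x / 2) ^ 2)) := by
    funext z; rw [besselJ_one_eq]; ring
  rw [h2, besselJ_zero_eq]
  exact h.congr_deriv (by ring)

theorem hasDerivAt_mul_besselI_one (x : ℝ) :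
    HasDerivAt (fun x => x * besselI 1 x) (x * besselI 0 x) x := by
  have h := ((hasDerivAt_mul_besselSeries_one (s := 1) (by simp) _).comp x
    (hasDerivAt_half_sq x)).const_mul 2
  have h2 : (fun x => x * besselI 1 x) =
      fun x => 2 * ((x / 2) ^ 2 * besselSeries 1 1 ((x / 2) ^ 2)) := by
    funext z; rw [besselI_one_eq]; ring
  rw [h2, besselI_zero_eq]
  exact h.congr_deriv (by ring)

theorem continuous_besselJ_zero : Continuous (besselJ 0) :=
  continuous_iff_continuousAt.2 fun x => (hasDerivAt_besselJ_zero x).continuousAt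

theorem continuous_besselI_zero : Continuous (besselI 0) :=
  continuous_iff_continuousAt.2 fun x => (hasDerivAt_besselI_zero x).continuousAt

theorem besselI_zero_at_zero : besselI 0 0 = 1 := by
  rw [besselI, tsum_eq_single 0 (fun m hm => by simp [hm])]; simp

theorem besselI_zero_pos (x : ℝ) : 0 < besselI 0 x := by
  rw [besselI]
  have hs : Summable fun m : ℕ => 1 / ((m.factorial : ℝ) * ((m + 0).factorial : ℝ))
      * (x / 2) ^ (2 * m + 0) := by
    have := summable_mul_pow_of_abs_le
      (fun m => abs_besselSeries_coeff_le (s := 1) (by simp) m m (m + 0)) ((x / 2) ^ 2)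
    simpa [pow_mul] using this
  refine hs.tsum_pos (fun m => ?_) 0 (by simp)
  simp only [add_zero, pow_mul]; positivity

/-! ### Modified Bessel functions of the second kind -/

/-- `∫_0^∞ exp(-x cosh t) cosh(t)^k dt`. -/
noncomputable def coshMoment (k : ℕ) (x : ℝ) : ℝ :=
  ∫ t in Ioi (0 : ℝ), Real.exp (-(x * Real.cosh t)) * Real.cosh t ^ k

theorem besselK_zero_eq : besselK 0 = coshMoment 0 := by
  funext x; simp [besselK, coshMoment]

theorem besselK_one_eq : besselK 1 = coshMoment 1 := by
  funext x; simp [besselK, coshMoment]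

/-- Half of the exponent absorbs the power: `u^k ≤ k! e^u` with `u = (x/2) cosh t`. The other half
still decays at least like `e^(-(x/2)t)`, since `t ≤ cosh t`. -/
theorem integrableOn_coshMoment (k : ℕ) {x : ℝ} (hx : 0 < x) :
    IntegrableOn (fun t => Real.exp (-(x * Real.cosh t)) * Real.cosh t ^ k) (Ioi 0) := by
  have hexp : IntegrableOn (fun t : ℝ => (k.factorial : ℝ) / (x / 2) ^ k
      * Real.exp (-(x / 2) * t)) (Ioi 0) :=
    (exp_neg_integrableOn_Ioi 0 (half_pos hx)).const_mul _
  refine hexp.mono' (by fun_prop) ((ae_restrict_iff' measurableSet_Ioi).2 (ae_of_all _ ?_))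
  intro t ht
  have ht' : (0 : ℝ) < t := ht
  have hc : t ≤ Real.cosh t :=
    (Real.self_le_sinh_iff.2 ht'.le).trans (Real.sinh_lt_cosh t).le
  have hc0 := Real.cosh_pos t
  rw [Real.norm_eq_abs, abs_of_nonneg (by positivity)]
  have h1 := Real.pow_div_factorial_le_exp (x := x / 2 * Real.cosh t) (by positivity) k
  have hk : (0 : ℝ) < k.factorial := by positivity
  have h2 : Real.cosh t ^ k ≤ k.factorial / (x / 2) ^ k * Real.exp (x / 2 * Real.cosh t) := by
    rw [div_le_iff₀ hk, mul_pow] at h1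
    rw [div_mul_eq_mul_div, le_div_iff₀ (by positivity)]
    linarith
  calc Real.exp (-(x * Real.cosh t)) * Real.cosh t ^ k
      ≤ Real.exp (-(x * Real.cosh t)) *
        (k.factorial / (x / 2) ^ k * Real.exp (x / 2 * Real.cosh t)) := by gcongr
    _ = k.factorial / (x / 2) ^ k * Real.exp (-(x / 2) * Real.cosh t) := by
        rw [mul_left_comm, ← Real.exp_add]; congr 2; ring
    _ ≤ k.factorial / (x / 2) ^ k * Real.exp (-(x / 2) * t) := by
        gcongr ?_ * Real.exp ?_
        nlinarith

/-- Differentiation under the integral; for parameters above `x/2` the derivative is dominated by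
the next moment at `x/2`. -/
theorem hasDerivAt_coshMoment (k : ℕ) {x : ℝ} (hx : 0 < x) :
    HasDerivAt (coshMoment k) (-coshMoment (k + 1) x) x := by
  have h := hasDerivAt_integral_of_dominated_loc_of_deriv_le
    (μ := volume.restrict (Ioi (0 : ℝ))) (s := Ioi (x / 2)) (x₀ := x)
    (F := fun x t => Real.exp (-(x * Real.cosh t)) * Real.cosh t ^ k)
    (F' := fun x t => -(Real.exp (-(x * Real.cosh t)) * Real.cosh t ^ (k + 1)))
    (bound := fun t => Real.exp (-(x / 2 * Real.cosh t)) * Real.cosh t ^ (k + 1))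
    (Ioi_mem_nhds (half_lt_self hx)) (Eventually.of_forall fun y => by fun_prop)
    (integrableOn_coshMoment k hx) (by fun_prop) (ae_of_all _ ?_)
    (integrableOn_coshMoment (k + 1) (half_pos hx)) (ae_of_all _ ?_)
  · rw [integral_neg] at h
    exact h.2
  · intro t y hy
    have hc0 := Real.cosh_pos t
    rw [norm_neg, Real.norm_eq_abs, abs_of_nonneg (by positivity)]
    have : x / 2 < y := hy
    gcongr
  · intro t y _
    have := (((hasDerivAt_id y).mul_const (Real.cosh t)).neg.exp).mul_const (Real.cosh t ^ k)
    refine this.congr_deriv ?_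
    simp only [id, Pi.neg_apply]
    ring

theorem coshMoment_pos (k : ℕ) {x : ℝ} (hx : 0 < x) : 0 < coshMoment k x := by
  rw [coshMoment, setIntegral_pos_iff_support_of_nonneg_ae]
  · have : Function.support (fun t => Real.exp (-(x * Real.cosh t)) * Real.cosh t ^ k) = univ := by
      ext t
      have hc0 := Real.cosh_pos t
      simp [hc0.ne']
    rw [this]; simp
  · exact ae_of_all _ fun t => by have hc0 := Real.cosh_pos t; simp only [Pi.zero_apply]; positivity
  · exact integrableOn_coshMoment k hx

theorem coshMoment_le_succ (k : ℕ) {x : ℝ} (hx : 0 < x) : coshMoment k x ≤ coshMoment (k + 1) x := by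
  refine setIntegral_mono (integrableOn_coshMoment k hx) (integrableOn_coshMoment _ hx) fun t => ?_
  have hc0 := Real.cosh_pos t
  dsimp only
  rw [pow_succ]
  have := Real.one_le_cosh t
  gcongr
  nlinarith [pow_pos hc0 k]

theorem coshMoment_antitone (k : ℕ) {x y : ℝ} (hx : 0 < x) (hxy : x ≤ y) :
    coshMoment k y ≤ coshMoment k x := by
  refine setIntegral_mono (integrableOn_coshMoment k (hx.trans_le hxy))
    (integrableOn_coshMoment _ hx) fun t => ?_
  have hc0 := Real.cosh_pos t
  dsimp only
  gcongr

theorem tendsto_exp_cosh_mul_atTop (k : ℕ) {x : ℝ} (hx : 0 < x) :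
    Tendsto (fun t => Real.exp (-(x * Real.cosh t)) * Real.cosh t ^ k) atTop (𝓝 0) := by
  have hcosh : Tendsto Real.cosh atTop atTop := by
    refine tendsto_atTop_mono' _ ?_ tendsto_id
    filter_upwards [eventually_ge_atTop 0] with t ht
    exact (Real.self_le_sinh_iff.2 ht).trans (Real.sinh_lt_cosh t).le
  have h := (Real.tendsto_pow_mul_exp_neg_atTop_nhds_zero k).comp (hcosh.const_mul_atTop hx)
  have h2 := h.mul_const ((x ^ k)⁻¹)
  rw [zero_mul] at h2
  refine h2.congr fun t => ?_
  have : x ^ k ≠ 0 := by positivity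
  simp only [Function.comp, mul_pow]
  field_simp

/-- The modified Bessel equation for `K₀`. -/
theorem coshMoment_two_eq {x : ℝ} (hx : 0 < x) :
    coshMoment 2 x = coshMoment 0 x + coshMoment 1 x / x := by
  have hlim : Tendsto (fun t => Real.sinh t * Real.exp (-(x * Real.cosh t))) atTop (𝓝 0) := by
    have h := tendsto_exp_cosh_mul_atTop 1 hx
    refine squeeze_zero' ?_ ?_ h
    · filter_upwards [eventually_ge_atTop 0] with t ht
      have := Real.sinh_nonneg_iff.2 ht
      positivity
    · filter_upwards with t
      rw [mul_comm, pow_one]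
      gcongr
      exact (Real.sinh_lt_cosh t).le
  -- The equation is an integration by parts: this total derivative integrates to zero, since `sinh
  -- t * exp(-x cosh t)` vanishes at both ends, and `sinh² = cosh² - 1` turns it into a relation
  -- between moments.
  have hderiv : ∀ t ∈ Ici (0 : ℝ),
      HasDerivAt (fun t => Real.sinh t * Real.exp (-(x * Real.cosh t)))
        (Real.exp (-(x * Real.cosh t)) * Real.cosh t ^ 1
          - x * (Real.exp (-(x * Real.cosh t)) * Real.cosh t ^ 2
            - Real.exp (-(x * Real.cosh t)) * Real.cosh t ^ 0)) t := by
    intro t _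
    refine ((Real.hasDerivAt_sinh t).fun_mul
      (((Real.hasDerivAt_cosh t).const_mul x).fun_neg.exp)).congr_deriv ?_
    rw [Real.cosh_sq t]
    ring
  have hi := fun k => integrableOn_coshMoment k hx
  have hI := integral_Ioi_of_hasDerivAt_of_tendsto' hderiv
    ((hi 1).sub (((hi 2).sub (hi 0)).const_mul x)) hlim
  have hsub := integral_sub (hi 1) (((hi 2).sub (hi 0)).const_mul x)
  have hsub2 := integral_sub (hi 2) (hi 0)
  simp only [Pi.sub_apply] at hsub
  rw [hsub, integral_const_mul, hsub2] at hI
  simp only [Real.sinh_zero, zero_mul, sub_zero] at hI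
  change coshMoment 1 x - x * (coshMoment 2 x - coshMoment 0 x) = 0 at hI
  field_simp
  linarith

theorem hasDerivAt_besselK_zero {x : ℝ} (hx : 0 < x) :
    HasDerivAt (besselK 0) (-besselK 1 x) x := by
  rw [besselK_zero_eq, besselK_one_eq]
  exact hasDerivAt_coshMoment 0 hx

theorem hasDerivAt_mul_besselK_one {x : ℝ} (hx : 0 < x) :
    HasDerivAt (fun x => x * besselK 1 x) (-(x * besselK 0 x)) x := by
  rw [besselK_zero_eq, besselK_one_eq]
  refine ((hasDerivAt_id x).fun_mul (hasDerivAt_coshMoment 1 hx)).congr_deriv ?_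
  rw [id, coshMoment_two_eq hx]
  field_simp
  ring

theorem besselK_zero_pos {x : ℝ} (hx : 0 < x) : 0 < besselK 0 x := by
  rw [besselK_zero_eq]; exact coshMoment_pos 0 hx

theorem besselK_one_pos {x : ℝ} (hx : 0 < x) : 0 < besselK 1 x := by
  rw [besselK_one_eq]; exact coshMoment_pos 1 hx

theorem besselK_zero_le_one {x : ℝ} (hx : 0 < x) : besselK 0 x ≤ besselK 1 x := by
  rw [besselK_zero_eq, besselK_one_eq]; exact coshMoment_le_succ 0 hx

theorem besselK_zero_antitone {x y : ℝ} (hx : 0 < x) (hxy : x ≤ y) :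
    besselK 0 y ≤ besselK 0 x := by
  rw [besselK_zero_eq]; exact coshMoment_antitone 0 hx hxy

/-! ### Limits of `K₀` and `K₁` at infinity and at zero -/

theorem besselK_zero_le_gaussian {x : ℝ} (hx : 0 < x) :
    besselK 0 x ≤ √(Real.pi / (x / 2)) / 2 := by
  rw [besselK_zero_eq, coshMoment, ← integral_gaussian_Ioi]
  refine setIntegral_mono_on (integrableOn_coshMoment 0 hx)
    (integrable_exp_neg_mul_sq (half_pos hx)).integrableOn measurableSet_Ioi fun t ht => ?_
  simp only [pow_zero, mul_one]
  have ht' : (0 : ℝ) < t := ht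
  -- This reduces `K₀` to a Gaussian integral. The resulting bound of order `x^(-1/2)` suffices both
  -- for `K₀ → 0` at infinity and for `x K₀ → 0` at zero.
  have : 1 + t ^ 2 / 2 ≤ Real.cosh t := by
    have h1 := Real.cosh_two_mul (t / 2)
    have h2 := Real.cosh_sq (t / 2)
    have h3 : t / 2 ≤ Real.sinh (t / 2) := Real.self_le_sinh_iff.2 (by positivity)
    rw [mul_div_cancel₀ t two_ne_zero] at h1
    nlinarith
  gcongr
  nlinarith

theorem tendsto_besselK_zero_atTop : Tendsto (besselK 0) atTop (𝓝 0) := by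
  have h : Tendsto (fun x : ℝ => √(Real.pi / (x / 2)) / 2) atTop (𝓝 (√0 / 2)) :=
    ((Real.continuous_sqrt.tendsto 0).comp (Tendsto.const_div_atTop
      (tendsto_id.atTop_div_const two_pos) _)).div_const 2
  rw [Real.sqrt_zero, zero_div] at h
  refine squeeze_zero' ?_ ?_ h
  · filter_upwards [eventually_gt_atTop 0] with x hx using (besselK_zero_pos hx).le
  · filter_upwards [eventually_gt_atTop 0] with x hx using besselK_zero_le_gaussian hx

theorem tendsto_mul_besselK_one_atTop : Tendsto (fun x => x * besselK 1 x) atTop (𝓝 0) := by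
  have h : Tendsto (fun x : ℝ => 2 * besselK 0 (x / 2)) atTop (𝓝 (2 * 0)) :=
    (tendsto_besselK_zero_atTop.comp (tendsto_id.atTop_div_const two_pos)).const_mul 2
  rw [mul_zero] at h
  refine squeeze_zero' ?_ ?_ h
  · filter_upwards [eventually_gt_atTop 0] with x hx using (mul_pos hx (besselK_one_pos hx)).le
  · filter_upwards [eventually_gt_atTop 0] with x hx
    rw [besselK_zero_eq, besselK_one_eq, coshMoment, coshMoment, ← integral_const_mul,
      ← integral_const_mul]
    refine setIntegral_mono ((integrableOn_coshMoment 1 hx).const_mul x)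
      ((integrableOn_coshMoment 0 (half_pos hx)).const_mul 2) fun t => ?_
    -- With `u = (x/2) cosh t`, the inequality `u ≤ e^u` gives `x cosh t * e^(-2u) ≤ 2 e^(-u)`, so
    -- the decay of `K₀` at `x/2` controls `x K₁(x)`.
    have h1 := Real.add_one_le_exp (x / 2 * Real.cosh t)
    simp only [pow_zero, mul_one, pow_one]
    have h2 : Real.exp (-(x / 2 * Real.cosh t)) =
        Real.exp (-(x * Real.cosh t)) * Real.exp (x / 2 * Real.cosh t) := by
      rw [← Real.exp_add]; congr 1; ring
    rw [h2]
    nlinarith [Real.exp_pos (-(x * Real.cosh t))]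

theorem tendsto_mul_besselK_zero_nhdsGT : Tendsto (fun x => x * besselK 0 x) (𝓝[>] 0) (𝓝 0) := by
  have h : Tendsto (fun x : ℝ => √(Real.pi * 2 * x) / 2) (𝓝[>] 0) (𝓝 (√(Real.pi * 2 * 0) / 2)) :=
    (Continuous.tendsto (by fun_prop) 0).mono_left nhdsWithin_le_nhds
  rw [mul_zero, Real.sqrt_zero, zero_div] at h
  refine squeeze_zero' ?_ ?_ h
  · filter_upwards [self_mem_nhdsWithin] with x hx
    exact (mul_pos hx (besselK_zero_pos hx)).le
  · filter_upwards [self_mem_nhdsWithin] with x hx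
    have hx' : (0 : ℝ) < x := hx
    calc x * besselK 0 x ≤ x * (√(Real.pi / (x / 2)) / 2) := by
          gcongr; exact besselK_zero_le_gaussian hx
      _ = √(Real.pi * 2 * x) / 2 := by
          rw [← mul_div_assoc, ← Real.sqrt_sq hx'.le, ← Real.sqrt_mul (by positivity),
            Real.sqrt_sq hx'.le]
          congr 2
          field_simp

/-- Replacing `cosh t` by `sinh t` in the integral for `x K₁(x)` makes it exactly `e^(-x)`. Since
`sinh ≤ cosh ≤ sinh + 1` for `t > 0`, this gives `e^(-x) ≤ x K₁(x) ≤ e^(-x) + x K₀(x)`, and both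
bounds tend to `1`. -/
theorem tendsto_mul_besselK_one_nhdsGT : Tendsto (fun x => x * besselK 1 x) (𝓝[>] 0) (𝓝 1) := by
  have hlow : ∀ x : ℝ, 0 < x → ∀ (h : IntegrableOn
      (fun t => x * (Real.sinh t * Real.exp (-(x * Real.cosh t)))) (Ioi 0)),
      ∫ t in Ioi (0 : ℝ), x * (Real.sinh t * Real.exp (-(x * Real.cosh t))) = Real.exp (-x) := by
    intro x hx h
    have h0 := tendsto_exp_cosh_mul_atTop 0 hx
    simp only [pow_zero, mul_one] at h0
    have := integral_Ioi_of_hasDerivAt_of_tendsto' (a := 0)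
      (f := fun t => -Real.exp (-(x * Real.cosh t)))
      (f' := fun t => x * (Real.sinh t * Real.exp (-(x * Real.cosh t)))) (fun t _ => by
        exact ((((Real.hasDerivAt_cosh t).const_mul x).fun_neg.exp).fun_neg).congr_deriv
          (by ring)) h
      (by simpa using h0.neg)
    rw [this]; simp
  have hint : ∀ x : ℝ, 0 < x → IntegrableOn
      (fun t => x * (Real.sinh t * Real.exp (-(x * Real.cosh t)))) (Ioi 0) := by
    intro x hx
    refine (((integrableOn_coshMoment 1 hx).const_mul x)).mono' (by fun_prop)
      ((ae_restrict_iff' measurableSet_Ioi).2 (ae_of_all _ fun t ht => ?_))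
    have hs := Real.sinh_nonneg_iff.2 (le_of_lt (show (0 : ℝ) < t from ht))
    rw [Real.norm_eq_abs, abs_of_nonneg (by positivity), pow_one, mul_comm (Real.sinh t)]
    gcongr
    exact (Real.sinh_lt_cosh t).le
  have h1 : Tendsto (fun x : ℝ => Real.exp (-x)) (𝓝[>] 0) (𝓝 1) := by
    have := (Continuous.tendsto (f := fun x : ℝ => Real.exp (-x)) (by fun_prop) 0).mono_left
      (nhdsWithin_le_nhds (s := Ioi 0))
    simpa using this
  have h2 : Tendsto (fun x : ℝ => Real.exp (-x) + x * besselK 0 x) (𝓝[>] 0) (𝓝 1) := by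
    simpa using h1.add tendsto_mul_besselK_zero_nhdsGT
  refine tendsto_of_tendsto_of_tendsto_of_le_of_le' h1 h2 ?_ ?_
  · filter_upwards [self_mem_nhdsWithin] with x hx
    have hx' : (0 : ℝ) < x := hx
    rw [← hlow x hx (hint x hx), besselK_one_eq, coshMoment, ← integral_const_mul]
    refine setIntegral_mono (hint x hx) ((integrableOn_coshMoment 1 hx).const_mul x) fun t => ?_
    simp only [pow_one, mul_comm (Real.sinh t)]
    gcongr
    exact (Real.sinh_lt_cosh t).le
  · filter_upwards [self_mem_nhdsWithin] with x hx
    have hx' : (0 : ℝ) < x := hx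
    rw [← hlow x hx (hint x hx), besselK_one_eq, besselK_zero_eq, coshMoment, coshMoment,
      ← integral_const_mul, ← integral_const_mul,
      ← integral_add (hint x hx) ((integrableOn_coshMoment 0 hx).const_mul x)]
    refine setIntegral_mono_on ((integrableOn_coshMoment 1 hx).const_mul x)
      ((hint x hx).add ((integrableOn_coshMoment 0 hx).const_mul x)) measurableSet_Ioi
      fun t ht => ?_
    have ht' : (0 : ℝ) < t := ht
    have he : Real.cosh t ≤ Real.sinh t + 1 := by
      have := Real.cosh_sub_sinh t
      have h3 : Real.exp (-t) ≤ 1 := Real.exp_le_one_iff.2 (by linarith)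
      linarith
    simp only [pow_one, pow_zero, mul_one]
    nlinarith [mul_pos hx' (Real.exp_pos (-(x * Real.cosh t)))]

/-! ### Lommel integrals -/

/-- `u` solves `r (r u')' = κ r² u` on `(0, ∞)`, and `p = r u'`. -/
structure IsRadialSolution (κ : ℝ) (u p : ℝ → ℝ) : Prop where
  deriv_fst : ∀ r, 0 < r → HasDerivAt u (p r / r) r
  deriv_snd : ∀ r, 0 < r → HasDerivAt p (κ * r * u r) r

namespace IsRadialSolution

variable {κ κ₁ κ₂ : ℝ} {u p u₁ p₁ u₂ p₂ : ℝ → ℝ}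

theorem continuousOn_fst (h : IsRadialSolution κ u p) : ContinuousOn u (Ioi 0) :=
  fun r hr => (h.deriv_fst r hr).continuousAt.continuousWithinAt

/-- Lagrange's identity: the cross terms `p₁ p₂ / r` cancel. This evaluates `∫ r u₁ u₂` whenever the
two parameters differ. -/
theorem hasDerivAt_wronskian (h₁ : IsRadialSolution κ₁ u₁ p₁) (h₂ : IsRadialSolution κ₂ u₂ p₂)
    {r : ℝ} (hr : 0 < r) :
    HasDerivAt (fun r => u₁ r * p₂ r - u₂ r * p₁ r) ((κ₂ - κ₁) * (r * u₁ r * u₂ r)) r := by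
  refine (((h₁.deriv_fst r hr).fun_mul (h₂.deriv_snd r hr)).fun_sub
    ((h₂.deriv_fst r hr).fun_mul (h₁.deriv_snd r hr))).congr_deriv ?_
  ring

/-- Substitute for Lagrange's identity when the parameters coincide and that identity says nothing
about `∫ r u₁ u₂`. -/
theorem hasDerivAt_energy (h₁ : IsRadialSolution κ u₁ p₁) (h₂ : IsRadialSolution κ u₂ p₂)
    {r : ℝ} (hr : 0 < r) :
    HasDerivAt (fun r => κ * r ^ 2 * u₁ r * u₂ r - p₁ r * p₂ r)
      (2 * κ * (r * u₁ r * u₂ r)) r := by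
  refine (((((hasDerivAt_pow 2 r).const_mul κ).fun_mul (h₁.deriv_fst r hr)).fun_mul
    (h₂.deriv_fst r hr)).fun_sub
    ((h₁.deriv_snd r hr).fun_mul (h₂.deriv_snd r hr))).congr_deriv ?_
  field_simp
  push_cast
  ring

end IsRadialSolution

theorem hasDerivAt_comp_const_mul {f : ℝ → ℝ} {f' c x : ℝ} (h : HasDerivAt f f' (c * x)) :
    HasDerivAt (fun x => f (c * x)) (c * f') x := by
  have h2 : HasDerivAt (fun x => c * x) c x := by
    simpa using (hasDerivAt_id x).const_mul c
  exact (h.comp x h2).congr_deriv (mul_comm _ _)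

theorem isRadialSolution_besselJ (Λ : ℝ) :
    IsRadialSolution (-Λ ^ 2) (fun r => besselJ 0 (Λ * r))
      (fun r => -(Λ * r * besselJ 1 (Λ * r))) where
  deriv_fst r hr := (hasDerivAt_comp_const_mul (hasDerivAt_besselJ_zero (Λ * r))).congr_deriv
    (by field_simp)
  deriv_snd r hr :=
    (hasDerivAt_comp_const_mul (hasDerivAt_mul_besselJ_one (Λ * r))).fun_neg.congr_deriv (by ring)

theorem isRadialSolution_besselI (Γ : ℝ) :
    IsRadialSolution (Γ ^ 2) (fun r => besselI 0 (Γ * r)) (fun r => Γ * r * besselI 1 (Γ * r)) where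
  deriv_fst r hr := (hasDerivAt_comp_const_mul (hasDerivAt_besselI_zero (Γ * r))).congr_deriv
    (by field_simp)
  deriv_snd r hr :=
    (hasDerivAt_comp_const_mul (hasDerivAt_mul_besselI_one (Γ * r))).congr_deriv (by ring)

theorem isRadialSolution_besselK {Γ : ℝ} (hΓ : 0 < Γ) :
    IsRadialSolution (Γ ^ 2) (fun r => besselK 0 (Γ * r))
      (fun r => -(Γ * r * besselK 1 (Γ * r))) where
  deriv_fst r hr :=
    (hasDerivAt_comp_const_mul (hasDerivAt_besselK_zero (mul_pos hΓ hr))).congr_deriv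
      (by field_simp)
  deriv_snd r hr :=
    (hasDerivAt_comp_const_mul (hasDerivAt_mul_besselK_one (mul_pos hΓ hr))).fun_neg.congr_deriv
      (by ring)

/-! ### Behaviour at the endpoints of `(0, ∞)` -/

theorem tendsto_const_mul_nhdsGT_zero {Γ : ℝ} (hΓ : 0 < Γ) :
    Tendsto (fun r : ℝ => Γ * r) (𝓝[>] 0) (𝓝[>] 0) := by
  refine tendsto_nhdsWithin_iff.2 ⟨?_, ?_⟩
  · have := (Continuous.tendsto (f := fun r : ℝ => Γ * r) (by fun_prop) 0).mono_left
      (nhdsWithin_le_nhds (s := Ioi 0))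
    simpa using this
  · filter_upwards [self_mem_nhdsWithin] with r hr using mul_pos hΓ hr

theorem continuous_mul_besselI_one : Continuous fun x => x * besselI 1 x :=
  continuous_iff_continuousAt.2 fun x => (hasDerivAt_mul_besselI_one x).continuousAt

theorem continuous_mul_besselJ_one : Continuous fun x => x * besselJ 1 x :=
  continuous_iff_continuousAt.2 fun x => (hasDerivAt_mul_besselJ_one x).continuousAt


theorem continuous_besselI_one : Continuous (besselI 1) := by
  have h : Continuous (besselSeries 1 1) := continuous_besselSeries (by simp) 1
  rw [show besselI 1 = _ from funext besselI_one_eq]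
  fun_prop

/-- Up to the factor `Γ²` the integrand is the derivative of the flux `-Γ r K₁(Γ r)`. It is
nonnegative and the flux has finite limits at both ends, so it is integrable without any pointwise
estimate. -/
theorem integrableOn_mul_besselK_zero {Γ : ℝ} (hΓ : 0 < Γ) :
    IntegrableOn (fun r => r * besselK 0 (Γ * r)) (Ioi 0) := by
  have hp := isRadialSolution_besselK hΓ
  set p := fun r => -(Γ * r * besselK 1 (Γ * r)) with hpdef
  have h0 : Tendsto p (𝓝[>] 0) (𝓝 (-1)) :=
    (tendsto_mul_besselK_one_nhdsGT.comp (tendsto_const_mul_nhdsGT_zero hΓ)).neg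
  have hinf : Tendsto p atTop (𝓝 (-0)) :=
    (tendsto_mul_besselK_one_atTop.comp (tendsto_id.const_mul_atTop hΓ)).neg
  have hI : IntegrableOn (fun r => Γ ^ 2 * r * besselK 0 (Γ * r)) (Ioi 0) := by
    -- Continuity at the left endpoint is required, so the flux is given its limit `-1` at `0`.
    refine integrableOn_Ioi_deriv_of_nonneg (g := Function.update p 0 (-1)) (l := -0) ?_ ?_ ?_ ?_
    · rw [continuousWithinAt_update_same, Ici_sdiff_left]
      exact h0
    · intro x hx
      refine (hp.deriv_snd x hx).congr_of_eventuallyEq ?_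
      filter_upwards [Ioi_mem_nhds hx] with y hy
      exact Function.update_of_ne (ne_of_gt hy) _ _
    · intro x hx
      have hx' : 0 < x := hx
      have := besselK_zero_pos (mul_pos hΓ hx')
      positivity
    · refine hinf.congr' ?_
      filter_upwards [eventually_gt_atTop 0] with y hy
      exact (Function.update_of_ne (ne_of_gt hy) _ _).symm
  refine IntegrableOn.congr_fun (hI.const_mul (Γ ^ 2)⁻¹) (fun r _ => ?_) measurableSet_Ioi
  field_simp

theorem continuousOn_besselK_zero_mul {Γ : ℝ} (hΓ : 0 < Γ) :
    ContinuousOn (fun r => besselK 0 (Γ * r)) (Ioi 0) :=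
  (isRadialSolution_besselK hΓ).continuousOn_fst

theorem continuous_besselI_zero_mul (Γ : ℝ) : Continuous fun r => besselI 0 (Γ * r) :=
  continuous_besselI_zero.comp (continuous_const.mul continuous_id)

theorem continuous_besselJ_zero_mul (Λ : ℝ) : Continuous fun r => besselJ 0 (Λ * r) :=
  continuous_besselJ_zero.comp (continuous_const.mul continuous_id)

theorem continuous_flux_besselI (Γ : ℝ) : Continuous fun r => Γ * r * besselI 1 (Γ * r) :=
  continuous_mul_besselI_one.comp (continuous_const.mul continuous_id)

theorem continuous_flux_besselJ (Λ : ℝ) : Continuous fun r => Λ * r * besselJ 1 (Λ * r) :=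
  continuous_mul_besselJ_one.comp (continuous_const.mul continuous_id)

theorem intervalIntegrable_mul_K_I {Γ₁ : ℝ} (Γ₂ : ℝ) (hΓ₁ : 0 < Γ₁) {a b : ℝ} (ha : 0 ≤ a)
    (hab : a ≤ b) :
    IntervalIntegrable (fun r => r * besselK 0 (Γ₁ * r) * besselI 0 (Γ₂ * r)) volume a b := by
  rw [intervalIntegrable_iff_integrableOn_Icc_of_le hab]
  refine IntegrableOn.mul_continuousOn ?_ (continuous_besselI_zero_mul Γ₂).continuousOn isCompact_Icc
  rw [integrableOn_Icc_iff_integrableOn_Ioc]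
  exact (integrableOn_mul_besselK_zero hΓ₁).mono_set fun r hr => ha.trans_lt hr.1

theorem integrableOn_mul_K_K {Γ₁ Γ₂ : ℝ} (hΓ₁ : 0 < Γ₁) (hΓ₂ : 0 < Γ₂) {d : ℝ} (hd : 0 < d) :
    IntegrableOn (fun r => r * besselK 0 (Γ₁ * r) * besselK 0 (Γ₂ * r)) (Ioi d) := by
  have hsub : Ioi d ⊆ Ioi 0 := Ioi_subset_Ioi hd.le
  refine Integrable.mul_bdd (c := besselK 0 (Γ₂ * d))
    ((integrableOn_mul_besselK_zero hΓ₁).mono_set hsub)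
    (((continuousOn_besselK_zero_mul hΓ₂).mono hsub).aestronglyMeasurable measurableSet_Ioi)
    ((ae_restrict_iff' measurableSet_Ioi).2 (ae_of_all _ fun r hr => ?_))
  have hr' : d < r := hr
  rw [Real.norm_eq_abs, abs_of_pos (besselK_zero_pos (mul_pos hΓ₂ (hd.trans hr')))]
  exact besselK_zero_antitone (mul_pos hΓ₂ hd) (by gcongr)

theorem tendsto_besselI_zero_mul_nhdsGT (Γ : ℝ) :
    Tendsto (fun r => besselI 0 (Γ * r)) (𝓝[>] 0) (𝓝 1) := by
  have := ((continuous_besselI_zero_mul Γ).tendsto 0).mono_left (nhdsWithin_le_nhds (s := Ioi 0))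
  simpa [besselI_zero_at_zero] using this

/-- `∫_0^a r J₀(Λ r) I₀(Γ r) dr`. -/
theorem integral_mul_J_I (Λ Γ : ℝ) {a : ℝ} (ha : 0 < a) :
    (Γ ^ 2 + Λ ^ 2) * ∫ r in (0)..a, r * besselJ 0 (Λ * r) * besselI 0 (Γ * r) =
      a * (Λ * besselI 0 (Γ * a) * besselJ 1 (Λ * a)
        + Γ * besselJ 0 (Λ * a) * besselI 1 (Γ * a)) := by
  have hJ := continuous_besselJ_zero_mul Λ
  have hI := continuous_besselI_zero_mul Γ
  have hJ1 := continuous_flux_besselJ Λ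
  have hI1 := continuous_flux_besselI Γ
  have h := intervalIntegral.integral_eq_sub_of_hasDerivAt_of_le ha.le
    (ContinuousOn.sub (hJ.mul hI1).continuousOn (hI.mul hJ1.neg).continuousOn)
    (fun r hr => (isRadialSolution_besselJ Λ).hasDerivAt_wronskian
      (isRadialSolution_besselI Γ) hr.1)
    ((continuous_const.mul ((continuous_id.mul hJ).mul hI)).intervalIntegrable _ _)
  rw [intervalIntegral.integral_const_mul] at h
  simp only [Pi.sub_apply, Pi.mul_apply, Pi.neg_apply] at h
  rw [show Γ ^ 2 + Λ ^ 2 = Γ ^ 2 - -Λ ^ 2 by ring, h]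
  ring

/-- `∫_0^a r J₀(Λ r)² dr`. -/
theorem integral_mul_J_J {Λ : ℝ} (hΛ : Λ ≠ 0) {a : ℝ} (ha : 0 < a) :
    ∫ r in (0)..a, r * besselJ 0 (Λ * r) * besselJ 0 (Λ * r) =
      a ^ 2 / 2 * (besselJ 1 (Λ * a) ^ 2 + besselJ 0 (Λ * a) ^ 2) := by
  have hJ := continuous_besselJ_zero_mul Λ
  have hJ1 := continuous_flux_besselJ Λ
  have h := intervalIntegral.integral_eq_sub_of_hasDerivAt_of_le ha.le
    (ContinuousOn.sub ((((continuous_const (y := -Λ ^ 2)).mul (continuous_pow 2)).mul hJ).mul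
      hJ).continuousOn (hJ1.neg.mul hJ1.neg).continuousOn)
    (fun r hr => (isRadialSolution_besselJ Λ).hasDerivAt_energy (isRadialSolution_besselJ Λ) hr.1)
    ((continuous_const.mul ((continuous_id.mul hJ).mul hJ)).intervalIntegrable _ _)
  rw [intervalIntegral.integral_const_mul] at h
  simp only [Pi.sub_apply, Pi.mul_apply, Pi.neg_apply] at h
  refine mul_left_cancel₀ (show 2 * -Λ ^ 2 ≠ 0 by simpa using hΛ) (h.trans ?_)
  ring

/-- The Wronskian of `K₀(Γ₁ r)` and `I₀(Γ₂ r)`, multiplied by `r`. -/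
noncomputable def wronskianKI (Γ₁ Γ₂ r : ℝ) : ℝ :=
  besselK 0 (Γ₁ * r) * (Γ₂ * r * besselI 1 (Γ₂ * r))
    - besselI 0 (Γ₂ * r) * -(Γ₁ * r * besselK 1 (Γ₁ * r))

theorem tendsto_wronskianKI {Γ₁ : ℝ} (Γ₂ : ℝ) (hΓ₁ : 0 < Γ₁) :
    Tendsto (wronskianKI Γ₁ Γ₂) (𝓝[>] 0) (𝓝 1) := by
  have hK0 := tendsto_mul_besselK_zero_nhdsGT.comp (tendsto_const_mul_nhdsGT_zero hΓ₁)
  have hK1 := tendsto_mul_besselK_one_nhdsGT.comp (tendsto_const_mul_nhdsGT_zero hΓ₁)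
  have hI0 := tendsto_besselI_zero_mul_nhdsGT Γ₂
  have hI1 : Tendsto (fun r => Γ₂ / Γ₁ * besselI 1 (Γ₂ * r)) (𝓝[>] 0) (𝓝 0) := by
    have := (((continuous_besselI_one.comp
      (continuous_const.mul continuous_id : Continuous fun r => Γ₂ * r)).tendsto 0).mono_left
        (nhdsWithin_le_nhds (s := Ioi 0))).const_mul (Γ₂ / Γ₁)
    simpa [besselI_one_eq] using this
  have h := (hK0.mul hI1).add (hI0.mul hK1)
  rw [zero_mul, zero_add, one_mul] at h
  refine h.congr fun r => ?_
  simp only [wronskianKI, Function.comp]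
  field_simp
  ring

/-- With equal parameters Lagrange's identity makes the expression constant on `(0, ∞)`; its limit
at `0` fixes the constant. -/
theorem wronskianKI_self {Γ r : ℝ} (hΓ : 0 < Γ) (hr : 0 < r) : wronskianKI Γ Γ r = 1 := by
  have hd : ∀ x ∈ Ioi (0 : ℝ), HasDerivAt (wronskianKI Γ Γ) 0 x := fun x hx =>
    ((isRadialSolution_besselK hΓ).hasDerivAt_wronskian (isRadialSolution_besselI Γ)
      hx).congr_deriv (by ring)
  refine tendsto_nhds_unique (tendsto_const_nhds.congr' ?_) (tendsto_wronskianKI Γ hΓ)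
  filter_upwards [self_mem_nhdsWithin] with x hx
  exact isOpen_Ioi.is_const_of_deriv_eq_zero isPreconnected_Ioi
    (fun y hy => (hd y hy).differentiableAt.differentiableWithinAt)
    (fun y hy => (hd y hy).deriv) hr hx

/-- `∫_0^a r K₀(Γ₁ r) I₀(Γ₂ r) dr`. -/
theorem integral_zero_mul_K_I {Γ₁ Γ₂ : ℝ} (hΓ₁ : 0 < Γ₁) {a : ℝ} (ha : 0 < a) :
    (Γ₂ ^ 2 - Γ₁ ^ 2) * ∫ r in (0)..a, r * besselK 0 (Γ₁ * r) * besselI 0 (Γ₂ * r) =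
      wronskianKI Γ₁ Γ₂ a - 1 := by
  have hd : ∀ r, 0 < r → HasDerivAt (wronskianKI Γ₁ Γ₂) _ r := fun r hr =>
    (isRadialSolution_besselK hΓ₁).hasDerivAt_wronskian (isRadialSolution_besselI Γ₂) hr
  rw [← intervalIntegral.integral_const_mul]
  exact intervalIntegral.integral_eq_sub_of_hasDerivAt_of_tendsto ha (fun r hr => hd r hr.1)
    ((intervalIntegrable_mul_K_I Γ₂ hΓ₁ le_rfl ha.le).const_mul _)
    (tendsto_wronskianKI Γ₂ hΓ₁) ((hd a ha).continuousAt.tendsto.mono_left nhdsWithin_le_nhds)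

/-- `∫_a^d r K₀(Γ₁ r) I₀(Γ₂ r) dr`. -/
theorem integral_mul_K_I {Γ₁ Γ₂ : ℝ} (hΓ₁ : 0 < Γ₁) {a d : ℝ} (ha : 0 < a) (had : a ≤ d) :
    (Γ₂ ^ 2 - Γ₁ ^ 2) * ∫ r in a..d, r * besselK 0 (Γ₁ * r) * besselI 0 (Γ₂ * r) =
      wronskianKI Γ₁ Γ₂ d - wronskianKI Γ₁ Γ₂ a := by
  rw [← intervalIntegral.integral_const_mul]
  refine intervalIntegral.integral_eq_sub_of_hasDerivAt (fun r hr =>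
    (isRadialSolution_besselK hΓ₁).hasDerivAt_wronskian (isRadialSolution_besselI Γ₂) ?_)
    ((intervalIntegrable_mul_K_I Γ₂ hΓ₁ ha.le had).const_mul _)
  rw [uIcc_of_le had] at hr
  exact ha.trans_le hr.1

theorem tendsto_mul_besselK_zero_atTop : Tendsto (fun x => x * besselK 0 x) atTop (𝓝 0) := by
  refine squeeze_zero' ?_ ?_ tendsto_mul_besselK_one_atTop
  · filter_upwards [eventually_gt_atTop 0] with x hx using (mul_pos hx (besselK_zero_pos hx)).le
  · filter_upwards [eventually_gt_atTop 0] with x hx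
    have := besselK_zero_le_one hx
    gcongr

/-- `∫_d^∞ r K₀(Γ₁ r) K₀(Γ₂ r) dr`. -/
theorem integral_Ioi_mul_K_K {Γ₁ Γ₂ : ℝ} (hΓ₁ : 0 < Γ₁) (hΓ₂ : 0 < Γ₂) {d : ℝ} (hd : 0 < d) :
    (Γ₂ ^ 2 - Γ₁ ^ 2) * ∫ r in Ioi d, r * besselK 0 (Γ₁ * r) * besselK 0 (Γ₂ * r) =
      besselK 0 (Γ₁ * d) * (Γ₂ * d * besselK 1 (Γ₂ * d))
        - besselK 0 (Γ₂ * d) * (Γ₁ * d * besselK 1 (Γ₁ * d)) := by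
  have h0 : ∀ {Γ : ℝ}, 0 < Γ → Tendsto (fun r => besselK 0 (Γ * r)) atTop (𝓝 0) := fun hΓ =>
    tendsto_besselK_zero_atTop.comp (tendsto_id.const_mul_atTop hΓ)
  have h1 : ∀ {Γ : ℝ}, 0 < Γ → Tendsto (fun r => -(Γ * r * besselK 1 (Γ * r))) atTop (𝓝 (-0)) :=
    fun hΓ => (tendsto_mul_besselK_one_atTop.comp (tendsto_id.const_mul_atTop hΓ)).neg
  rw [← integral_const_mul]
  rw [integral_Ioi_of_hasDerivAt_of_tendsto' (fun r hr =>
    (isRadialSolution_besselK hΓ₁).hasDerivAt_wronskian (isRadialSolution_besselK hΓ₂)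
      (hd.trans_le hr)) ((integrableOn_mul_K_K hΓ₁ hΓ₂ hd).const_mul _)
      (((h0 hΓ₁).mul (h1 hΓ₂)).sub ((h0 hΓ₂).mul (h1 hΓ₁)))]
  ring

/-- `∫_d^∞ r K₀(Γ r)² dr`. -/
theorem integral_Ioi_mul_K_K_self {Γ : ℝ} (hΓ : 0 < Γ) {d : ℝ} (hd : 0 < d) :
    ∫ r in Ioi d, r * besselK 0 (Γ * r) * besselK 0 (Γ * r) =
      d ^ 2 / 2 * (besselK 1 (Γ * d) ^ 2 - besselK 0 (Γ * d) ^ 2) := by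
  have h0 : Tendsto (fun r => Γ * r * besselK 0 (Γ * r)) atTop (𝓝 0) :=
    tendsto_mul_besselK_zero_atTop.comp (tendsto_id.const_mul_atTop hΓ)
  have h1 : Tendsto (fun r => -(Γ * r * besselK 1 (Γ * r))) atTop (𝓝 (-0)) :=
    (tendsto_mul_besselK_one_atTop.comp (tendsto_id.const_mul_atTop hΓ)).neg
  have h2 := ((h0.mul h0).sub (h1.mul h1)).congr
    (f₂ := fun r => Γ ^ 2 * r ^ 2 * besselK 0 (Γ * r) * besselK 0 (Γ * r)
      - -(Γ * r * besselK 1 (Γ * r)) * -(Γ * r * besselK 1 (Γ * r))) fun r => by ring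
  have h := integral_Ioi_of_hasDerivAt_of_tendsto' (fun r hr =>
    (isRadialSolution_besselK hΓ).hasDerivAt_energy (isRadialSolution_besselK hΓ)
      (hd.trans_le hr)) ((integrableOn_mul_K_K hΓ hΓ hd).const_mul _) h2
  rw [integral_const_mul] at h
  refine mul_left_cancel₀ (show 2 * Γ ^ 2 ≠ 0 by positivity) (h.trans ?_)
  ring

/-- The antiderivative `r² (I₀ K₀ + I₁ K₁) / 2` of `r K₀ I₀`. -/
noncomputable def energyKI (Γ r : ℝ) : ℝ :=
  r ^ 2 / 2 * (besselI 0 (Γ * r) * besselK 0 (Γ * r) + besselI 1 (Γ * r) * besselK 1 (Γ * r))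

theorem hasDerivAt_energyKI {Γ r : ℝ} (hΓ : 0 < Γ) (hr : 0 < r) :
    HasDerivAt (energyKI Γ) (r * besselK 0 (Γ * r) * besselI 0 (Γ * r)) r := by
  have h := ((isRadialSolution_besselK hΓ).hasDerivAt_energy (isRadialSolution_besselI Γ)
    hr).const_mul (2 * Γ ^ 2)⁻¹
  have he : energyKI Γ = fun r => (2 * Γ ^ 2)⁻¹ * (Γ ^ 2 * r ^ 2 * besselK 0 (Γ * r)
      * besselI 0 (Γ * r) - -(Γ * r * besselK 1 (Γ * r)) * (Γ * r * besselI 1 (Γ * r))) := by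
    funext r
    rw [energyKI]
    field_simp
    ring
  rw [he]
  exact h.congr_deriv (by field_simp)

theorem tendsto_energyKI {Γ : ℝ} (hΓ : 0 < Γ) : Tendsto (energyKI Γ) (𝓝[>] 0) (𝓝 0) := by
  have hK0 := tendsto_mul_besselK_zero_nhdsGT.comp (tendsto_const_mul_nhdsGT_zero hΓ)
  have hK1 := tendsto_mul_besselK_one_nhdsGT.comp (tendsto_const_mul_nhdsGT_zero hΓ)
  have hI0 : Tendsto (fun r => r * besselI 0 (Γ * r)) (𝓝[>] 0) (𝓝 0) := by
    have := ((show Continuous fun r => r * besselI 0 (Γ * r) from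
      continuous_id.mul (continuous_besselI_zero_mul Γ)).tendsto 0).mono_left
      (nhdsWithin_le_nhds (s := Ioi 0))
    simpa using this
  have hI1 : Tendsto (fun r => r * besselI 1 (Γ * r)) (𝓝[>] 0) (𝓝 0) := by
    have := ((show Continuous fun r => r * besselI 1 (Γ * r) from
      continuous_id.mul (continuous_besselI_one.comp
        (continuous_const.mul continuous_id))).tendsto 0).mono_left
      (nhdsWithin_le_nhds (s := Ioi 0))
    simpa using this
  have h := ((hK0.mul hI0).add (hK1.mul hI1)).const_mul (2 * Γ)⁻¹
  rw [mul_zero, mul_zero, add_zero, mul_zero] at h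
  refine h.congr fun r => ?_
  simp only [energyKI, Function.comp]
  field_simp

theorem integral_zero_mul_K_I_self {Γ : ℝ} (hΓ : 0 < Γ) {a : ℝ} (ha : 0 < a) :
    ∫ r in (0)..a, r * besselK 0 (Γ * r) * besselI 0 (Γ * r) = energyKI Γ a := by
  rw [← sub_zero (energyKI Γ a)]
  exact intervalIntegral.integral_eq_sub_of_hasDerivAt_of_tendsto ha
    (fun r hr => hasDerivAt_energyKI hΓ hr.1) (intervalIntegrable_mul_K_I Γ hΓ le_rfl ha.le)
    (tendsto_energyKI hΓ)
    ((hasDerivAt_energyKI hΓ ha).continuousAt.tendsto.mono_left nhdsWithin_le_nhds)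

theorem integral_mul_K_I_self {Γ : ℝ} (hΓ : 0 < Γ) {a d : ℝ} (ha : 0 < a) (had : a ≤ d) :
    ∫ r in a..d, r * besselK 0 (Γ * r) * besselI 0 (Γ * r) = energyKI Γ d - energyKI Γ a := by
  refine intervalIntegral.integral_eq_sub_of_hasDerivAt
    (fun r hr => hasDerivAt_energyKI hΓ ?_) (intervalIntegrable_mul_K_I Γ hΓ ha.le had)
  rw [uIcc_of_le had] at hr
  exact ha.trans_le hr.1

/-! ### The mean value of `K₀(Γ |x - c|)` over a circle -/

/-- Joint continuity of `F'` bounds it on the compact product of a small closed ball and the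
integration interval, which supplies the dominating constant. -/
theorem hasDerivAt_intervalIntegral_of_continuousOn {F F' : ℝ → ℝ → ℝ} {d x₀ a b : ℝ}
    (hx₀ : x₀ ∈ Ioo (-d) d) (hF : ∀ x ∈ Ioo (-d) d, Continuous (F x))
    (hF' : ContinuousOn (Function.uncurry F') (Ioo (-d) d ×ˢ univ))
    (hd : ∀ x ∈ Ioo (-d) d, ∀ t, HasDerivAt (fun x => F x t) (F' x t) x) :
    HasDerivAt (fun x => ∫ t in a..b, F x t) (∫ t in a..b, F' x₀ t) x₀ := by
  obtain ⟨ε, hε, hball⟩ := Metric.isOpen_iff.1 isOpen_Ioo x₀ hx₀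
  have hsub : Metric.closedBall x₀ (ε / 2) ⊆ Ioo (-d) d :=
    (Metric.closedBall_subset_ball (half_lt_self hε)).trans hball
  have hcont' : Continuous (F' x₀) := by
    rw [← continuousOn_univ]
    exact hF'.comp (f := fun t => (x₀, t)) (by fun_prop) fun t _ => ⟨hx₀, mem_univ t⟩
  obtain ⟨C, hC⟩ := ((isCompact_closedBall x₀ (ε / 2)).prod (isCompact_uIcc (a := a)
    (b := b))).exists_bound_of_continuousOn (hF'.mono (prod_mono hsub (subset_univ _)))
  refine (intervalIntegral.hasDerivAt_integral_of_dominated_loc_of_deriv_le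
    (s := Metric.closedBall x₀ (ε / 2)) (F' := F') (bound := fun _ => C)
    (Metric.closedBall_mem_nhds x₀ (half_pos hε)) ?_ ((hF x₀ hx₀).intervalIntegrable _ _)
    hcont'.aestronglyMeasurable (ae_of_all _ fun t ht x hx => ?_) (by simp)
    (ae_of_all _ fun t _ x hx => hd x (hsub hx) t)).2
  · filter_upwards [isOpen_Ioo.mem_nhds hx₀] with x hx using (hF x hx).aestronglyMeasurable
  · exact hC (x, t) ⟨hx, uIoc_subset_uIcc ht⟩

/-- `K₀(Γ √ρ)` as a function of the squared distance. -/
noncomputable def kernelSq (Γ ρ : ℝ) : ℝ := besselK 0 (Γ * √ρ)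

/-- Derivative of `kernelSq`. -/
noncomputable def kernelSqDeriv (Γ ρ : ℝ) : ℝ := -(Γ * √ρ * besselK 1 (Γ * √ρ)) / (2 * ρ)

section CircleMean

variable {Γ d : ℝ}

theorem hasDerivAt_kernelSq (hΓ : 0 < Γ) {ρ : ℝ} (hρ : 0 < ρ) :
    HasDerivAt (kernelSq Γ) (kernelSqDeriv Γ ρ) ρ := by
  have hs := Real.sqrt_pos.2 hρ
  have h := ((hasDerivAt_comp_const_mul (hasDerivAt_besselK_zero (mul_pos hΓ hs))).comp ρ
    (Real.hasDerivAt_sqrt hρ.ne'))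
  refine HasDerivAt.congr_deriv (f := kernelSq Γ) h ?_
  rw [kernelSqDeriv]
  nth_rw 5 [← Real.sq_sqrt hρ.le]
  field_simp

/-- This is the modified Bessel equation in the variable `ρ = r²`: `ρ f'' + f' = (Γ²/4) f`. -/
theorem hasDerivAt_kernelSqDeriv (hΓ : 0 < Γ) {ρ : ℝ} (hρ : 0 < ρ) :
    HasDerivAt (kernelSqDeriv Γ) ((Γ ^ 2 / 4 * kernelSq Γ ρ - kernelSqDeriv Γ ρ) / ρ) ρ := by
  have hs := Real.sqrt_pos.2 hρ
  have h := ((hasDerivAt_comp_const_mul (hasDerivAt_mul_besselK_one (mul_pos hΓ hs))).comp ρ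
    (Real.hasDerivAt_sqrt hρ.ne'))
  have h2 := h.fun_neg.fun_div ((hasDerivAt_id ρ).const_mul 2) (by simpa using hρ.ne')
  refine HasDerivAt.congr_deriv (f := kernelSqDeriv Γ) h2 ?_
  simp only [kernelSqDeriv, kernelSq, id, Function.comp]
  have := Real.sq_sqrt hρ.le
  set s := √ρ
  rw [← this]
  field_simp
  ring

/-- The expression is the convex combination of `(d - r)²` and `(d + r)²` with weights `(1 ± cos
θ)/2`. Negative `r` is allowed so that `r = 0` is an interior point. -/
theorem circle_sq_pos {r : ℝ} (hr : r ∈ Ioo (-d) d) (θ : ℝ) :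
    0 < d ^ 2 + r ^ 2 - 2 * d * r * Real.cos θ := by
  have h1 := Real.neg_one_le_cos θ
  have h2 := Real.cos_le_one θ
  have h3 : 0 < d - r := by linarith [hr.2]
  have h4 : 0 < d + r := by linarith [hr.1]
  nlinarith [mul_pos h3 h3, mul_pos h4 h4, mul_nonneg (sub_nonneg.2 h2) (sq_nonneg (d + r)),
    mul_nonneg (neg_le_iff_add_nonneg.1 h1) (sq_nonneg (d - r))]

/-- The integral of `K₀(Γ |x - c|)` over the circle of radius `r`, where `|c| = d`. -/
noncomputable def circleIntegralK (Γ d r : ℝ) : ℝ :=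
  ∫ θ in -Real.pi..Real.pi, kernelSq Γ (d ^ 2 + r ^ 2 - 2 * d * r * Real.cos θ)

theorem circleIntegralK_comm (Γ d r : ℝ) : circleIntegralK Γ d r = circleIntegralK Γ r d := by
  unfold circleIntegralK
  congr 1; funext θ; congr 1; ring

/-- The radial derivative of `circleIntegralK`. -/
noncomputable def circleIntegralKDeriv (Γ d r : ℝ) : ℝ :=
  ∫ θ in -Real.pi..Real.pi, kernelSqDeriv Γ (d ^ 2 + r ^ 2 - 2 * d * r * Real.cos θ)
    * (2 * r - 2 * d * Real.cos θ)

theorem continuousOn_comp_circle_sq {f : ℝ → ℝ} (hf : ContinuousOn f (Ioi 0)) :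
    ContinuousOn (fun z : ℝ × ℝ => f (d ^ 2 + z.1 ^ 2 - 2 * d * z.1 * Real.cos z.2))
      (Ioo (-d) d ×ˢ univ) :=
  hf.comp (by fun_prop) fun z hz => circle_sq_pos hz.1 z.2

theorem continuous_comp_circle_sq {f : ℝ → ℝ} (hf : ContinuousOn f (Ioi 0)) {r : ℝ}
    (hr : r ∈ Ioo (-d) d) :
    Continuous (fun θ : ℝ => f (d ^ 2 + r ^ 2 - 2 * d * r * Real.cos θ)) := by
  rw [← continuousOn_univ]
  exact hf.comp (by fun_prop) fun θ _ => circle_sq_pos hr θ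

theorem hasDerivAt_circle_sq (d r θ : ℝ) :
    HasDerivAt (fun r => d ^ 2 + r ^ 2 - 2 * d * r * Real.cos θ) (2 * r - 2 * d * Real.cos θ) r := by
  refine (((hasDerivAt_pow 2 r).const_add (d ^ 2)).fun_sub
    (((hasDerivAt_id r).const_mul (2 * d)).mul_const (Real.cos θ))).congr_deriv ?_
  simp

theorem continuousOn_kernelSq (hΓ : 0 < Γ) : ContinuousOn (kernelSq Γ) (Ioi 0) :=
  fun _ hρ => (hasDerivAt_kernelSq hΓ hρ).continuousAt.continuousWithinAt

theorem continuousOn_kernelSqDeriv (hΓ : 0 < Γ) : ContinuousOn (kernelSqDeriv Γ) (Ioi 0) :=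
  fun _ hρ => (hasDerivAt_kernelSqDeriv hΓ hρ).continuousAt.continuousWithinAt

theorem continuousOn_kernelSqDeriv₂ (hΓ : 0 < Γ) :
    ContinuousOn (fun ρ => (Γ ^ 2 / 4 * kernelSq Γ ρ - kernelSqDeriv Γ ρ) / ρ) (Ioi 0) :=
  ((continuousOn_const.mul (continuousOn_kernelSq hΓ)).sub (continuousOn_kernelSqDeriv hΓ)).div
    continuousOn_id fun _ hρ => (ne_of_gt hρ)

theorem hasDerivAt_circleIntegralK (hΓ : 0 < Γ) {r : ℝ} (hr : r ∈ Ioo (-d) d) :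
    HasDerivAt (circleIntegralK Γ d) (circleIntegralKDeriv Γ d r) r := by
  refine hasDerivAt_intervalIntegral_of_continuousOn
    (F := fun r θ => kernelSq Γ (d ^ 2 + r ^ 2 - 2 * d * r * Real.cos θ))
    (F' := fun r θ => kernelSqDeriv Γ (d ^ 2 + r ^ 2 - 2 * d * r * Real.cos θ)
    * (2 * r - 2 * d * Real.cos θ)) hr
    (fun x hx => continuous_comp_circle_sq (continuousOn_kernelSq hΓ) hx)
    ((continuousOn_comp_circle_sq (continuousOn_kernelSqDeriv hΓ)).mul (by fun_prop))
    fun x hx θ => ?_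
  exact HasDerivAt.comp (h₂ := kernelSq Γ) x (hasDerivAt_kernelSq hΓ (circle_sq_pos hx θ))
    (hasDerivAt_circle_sq d x θ)

/-- In polar coordinates `Δu = Γ²u` reads `r ∂ᵣ(r ∂ᵣu) + ∂²u/∂θ² = Γ² r² u`. Integrating over the
circle removes the angular term, so the circular mean solves the radial equation. -/
theorem hasDerivAt_circle_flux (hΓ : 0 < Γ) {r : ℝ} (hr : r ∈ Ioo (-d) d) :
    HasDerivAt (fun r => r * circleIntegralKDeriv Γ d r) (Γ ^ 2 * r * circleIntegralK Γ d r) r := by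
  set f₁ := kernelSqDeriv Γ
  set f₂ := fun ρ => (Γ ^ 2 / 4 * kernelSq Γ ρ - kernelSqDeriv Γ ρ) / ρ with hf₂
  have hf₁c : ContinuousOn f₁ (Ioi 0) := continuousOn_kernelSqDeriv hΓ
  have hf₂c : ContinuousOn f₂ (Ioi 0) := continuousOn_kernelSqDeriv₂ hΓ
  set q : ℝ → ℝ → ℝ := fun r θ => d ^ 2 + r ^ 2 - 2 * d * r * Real.cos θ with hq
  have h := hasDerivAt_intervalIntegral_of_continuousOn (a := -Real.pi) (b := Real.pi)
    (F := fun r θ => f₁ (q r θ) * (2 * r ^ 2 - 2 * d * r * Real.cos θ))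
    (F' := fun r θ => f₂ (q r θ) * (2 * r - 2 * d * Real.cos θ)
        * (2 * r ^ 2 - 2 * d * r * Real.cos θ)
      + f₁ (q r θ) * (4 * r - 2 * d * Real.cos θ)) hr
    (fun x hx => (continuous_comp_circle_sq hf₁c hx).mul (by fun_prop))
    ((((continuousOn_comp_circle_sq hf₂c).mul (by fun_prop)).mul (by fun_prop)).add
      ((continuousOn_comp_circle_sq hf₁c).mul (by fun_prop)))
    (fun x hx θ => by
      have h1 := (hasDerivAt_kernelSqDeriv hΓ (circle_sq_pos hx θ)).comp x
        (hasDerivAt_circle_sq d x θ)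
      have h2 : HasDerivAt (fun r => 2 * r ^ 2 - 2 * d * r * Real.cos θ)
          (4 * x - 2 * d * Real.cos θ) x := by
        refine (((hasDerivAt_pow 2 x).const_mul 2).fun_sub
          (((hasDerivAt_id x).const_mul (2 * d)).mul_const (Real.cos θ))).congr_deriv ?_
        simp; ring
      exact h1.fun_mul h2)
  have hfun : (fun r => r * circleIntegralKDeriv Γ d r) = fun r => ∫ θ in -Real.pi..Real.pi,
      f₁ (q r θ) * (2 * r ^ 2 - 2 * d * r * Real.cos θ) := by
    funext x
    rw [circleIntegralKDeriv, ← intervalIntegral.integral_const_mul]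
    congr 1; funext θ; simp only [f₁, q]; ring
  rw [hfun]
  refine h.congr_deriv ?_
  -- The differentiated function is `(1/r) ∂u/∂θ` with the factor `r` cancelled, so `r = 0` causes
  -- no trouble. It vanishes at `±π`, hence its derivative integrates to zero.
  have hang : ∀ θ, HasDerivAt (fun θ => 2 * d * (f₁ (q r θ) * Real.sin θ))
      (2 * d * (f₂ (q r θ) * (2 * d * r * Real.sin θ) * Real.sin θ
        + f₁ (q r θ) * Real.cos θ)) θ := by
    intro θ
    have h1 : HasDerivAt (q r) (2 * d * r * Real.sin θ) θ := by
      refine (((Real.hasDerivAt_cos θ).const_mul (2 * d * r)).const_sub _).congr_deriv ?_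
      ring
    exact (((hasDerivAt_kernelSqDeriv hΓ (circle_sq_pos hr θ)).comp θ h1).fun_mul
      (Real.hasDerivAt_sin θ)).const_mul (2 * d)
  have hc₁ : Continuous fun θ => f₁ (q r θ) := continuous_comp_circle_sq hf₁c hr
  have hc₂ : Continuous fun θ => f₂ (q r θ) := continuous_comp_circle_sq hf₂c hr
  have hc₀ : Continuous fun θ => kernelSq Γ (q r θ) :=
    continuous_comp_circle_sq (continuousOn_kernelSq hΓ) hr
  have hcd : Continuous fun θ => 2 * d * (f₂ (q r θ) * (2 * d * r * Real.sin θ) * Real.sin θ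
      + f₁ (q r θ) * Real.cos θ) :=
    continuous_const.mul (((hc₂.mul (by fun_prop)).mul (by fun_prop)).add (hc₁.mul (by fun_prop)))
  have hzero := intervalIntegral.integral_eq_sub_of_hasDerivAt
    (a := -Real.pi) (b := Real.pi) (fun θ _ => hang θ)
    (hcd.intervalIntegrable _ _)
  simp only [Real.sin_neg, Real.sin_pi, neg_zero, mul_zero, sub_zero] at hzero
  rw [circleIntegralK, ← intervalIntegral.integral_const_mul, ← sub_zero (∫ θ in _.._, _ * _),
    ← hzero]
  refine Eq.trans ?_ (intervalIntegral.integral_sub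
    ((continuous_const.mul hc₀).intervalIntegrable _ _) (hcd.intervalIntegrable _ _))
  congr 1; funext θ
  have hqpos := circle_sq_pos hr θ
  have h2 : f₂ (q r θ) * q r θ = Γ ^ 2 / 4 * kernelSq Γ (q r θ) - f₁ (q r θ) := by
    simp only [hf₂]
    exact div_mul_cancel₀ _ hqpos.ne'
  have h3 := Real.sin_sq_add_cos_sq θ
  have h4 : kernelSq Γ (q r θ) * Γ ^ 2 = 4 * (f₂ (q r θ) * q r θ + f₁ (q r θ)) := by
    rw [h2]; ring
  have h5 : q r θ = d ^ 2 + r ^ 2 - 2 * d * r * Real.cos θ := rfl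
  change _ = Γ ^ 2 * r * kernelSq Γ (q r θ) - _
  rw [show Γ ^ 2 * r * kernelSq Γ (q r θ) = r * (kernelSq Γ (q r θ) * Γ ^ 2) by ring, h4]
  linear_combination (-4 * r * f₂ (q r θ)) * h5 + (4 * d ^ 2 * r * f₂ (q r θ)) * h3

/-- Mean value property of `K₀(Γ |x - c|)`. -/
theorem circleIntegralK_eq (hΓ : 0 < Γ) {r : ℝ} (hr0 : 0 ≤ r) (hr : r < d) :
    circleIntegralK Γ d r = 2 * Real.pi * (besselI 0 (Γ * r) * besselK 0 (Γ * d)) := by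
  have hd : 0 < d := hr0.trans_lt hr
  have hI0 : ∀ x, HasDerivAt (fun r => besselI 0 (Γ * r)) (Γ * besselI 1 (Γ * x)) x :=
    fun x => hasDerivAt_comp_const_mul (hasDerivAt_besselI_zero (Γ * x))
  have hI1 : ∀ x, HasDerivAt (fun r => Γ * r * besselI 1 (Γ * r))
      (Γ * (Γ * x * besselI 0 (Γ * x))) x :=
    fun x => hasDerivAt_comp_const_mul (hasDerivAt_mul_besselI_one (Γ * x))
  have hW : ∀ x ∈ Ioo (-d) d, HasDerivAt (fun r => circleIntegralK Γ d r
      * (Γ * r * besselI 1 (Γ * r)) - besselI 0 (Γ * r) * (r * circleIntegralKDeriv Γ d r)) 0 x := by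
    intro x hx
    refine (((hasDerivAt_circleIntegralK hΓ hx).fun_mul (hI1 x)).fun_sub
      ((hI0 x).fun_mul (hasDerivAt_circle_flux hΓ hx))).congr_deriv ?_
    ring
  -- The Wronskian with `I₀` is constant, and at the interior point `0` both terms carry a factor
  -- `x`. Hence it vanishes identically, and the quotient by `I₀` is constant.
  have hW0 : ∀ x ∈ Ioo (-d) d, circleIntegralK Γ d x
      * (Γ * x * besselI 1 (Γ * x)) - besselI 0 (Γ * x) * (x * circleIntegralKDeriv Γ d x) = 0 := by
    intro x hx
    have := isOpen_Ioo.is_const_of_deriv_eq_zero isPreconnected_Ioo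
      (fun y hy => (hW y hy).differentiableAt.differentiableWithinAt)
      (fun y hy => (hW y hy).deriv) hx (y := 0) ⟨by linarith, hd⟩
    simpa using this
  have hquot : ∀ x ∈ Ioo (-d) d, HasDerivAt (fun r => circleIntegralK Γ d r / besselI 0 (Γ * r))
      ((circleIntegralKDeriv Γ d x * besselI 0 (Γ * x)
        - circleIntegralK Γ d x * (Γ * besselI 1 (Γ * x))) / besselI 0 (Γ * x) ^ 2) x :=
    fun x hx => (hasDerivAt_circleIntegralK hΓ hx).fun_div (hI0 x) (besselI_zero_pos _).ne'
  have hval : circleIntegralK Γ d 0 = 2 * Real.pi * besselK 0 (Γ * d) := by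
    simp [circleIntegralK, kernelSq, Real.sqrt_sq hd.le, ← two_mul]
  rcases hr0.eq_or_lt with rfl | hr0
  · simp [hval, besselI_zero_at_zero]
  obtain ⟨c, hc, hslope⟩ := exists_hasDerivAt_eq_slope
    (fun r => circleIntegralK Γ d r / besselI 0 (Γ * r)) _ hr0
    (fun x hx => (hquot x ⟨by linarith [hx.1], by linarith [hx.2]⟩).continuousAt.continuousWithinAt)
    (fun x hx => hquot x ⟨by linarith [hx.1], by linarith [hx.2]⟩)
  have hnum : circleIntegralKDeriv Γ d c * besselI 0 (Γ * c)
        - circleIntegralK Γ d c * (Γ * besselI 1 (Γ * c)) = 0 := by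
    have := hW0 c ⟨by linarith [hc.1], by linarith [hc.2]⟩
    refine (mul_eq_zero.1 (?_ : c * _ = 0)).resolve_left hc.1.ne'
    linarith
  rw [hnum, zero_div, eq_comm, div_eq_zero_iff, or_iff_left (by linarith), sub_eq_zero] at hslope
  simp only [mul_zero, besselI_zero_at_zero, hval, div_one] at hslope
  rw [div_eq_iff (besselI_zero_pos _).ne'] at hslope
  rw [hslope]; ring

/-- The mean value over a circle of radius `r` of `K₀(Γ |x - c|)`, `|c| = d`. -/
noncomputable def radialGreen (Γ d r : ℝ) : ℝ :=
  if r < d then besselI 0 (Γ * r) * besselK 0 (Γ * d) else besselI 0 (Γ * d) * besselK 0 (Γ * r)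

theorem circleIntegralK_eq_radialGreen (hΓ : 0 < Γ) (hd : 0 < d) {r : ℝ} (hr0 : 0 < r)
    (hr : r ≠ d) : circleIntegralK Γ d r = 2 * Real.pi * radialGreen Γ d r := by
  rw [radialGreen]
  split_ifs with h
  · exact circleIntegralK_eq hΓ hr0.le h
  · rw [circleIntegralK_comm]
    exact circleIntegralK_eq hΓ hd.le (lt_of_le_of_ne (not_lt.1 h) hr.symm)

end CircleMean

/-! ### Integrals over the plane in polar coordinates -/

theorem integrableOn_comp_polarCoord_symm {F : ℝ × ℝ → ℝ} :
    IntegrableOn (fun p : ℝ × ℝ => p.1 * F (polarCoord.symm p))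
      (Ioi 0 ×ˢ Ioo (-Real.pi) Real.pi) ↔ Integrable F := by
  have h := integrableOn_image_iff_integrableOn_abs_det_fderiv_smul volume
    polarCoord.open_target.measurableSet
    (fun p _ => (hasFDerivAt_polarCoord_symm p).hasFDerivWithinAt) polarCoord.symm.injOn F
  rw [polarCoord.symm_image_target_eq_source,
    integrableOn_congr_set_ae polarCoord_source_ae_eq_univ, integrableOn_univ] at h
  rw [h, polarCoord_target]
  refine integrableOn_congr_fun (fun p hp => ?_) (measurableSet_Ioi.prod measurableSet_Ioo)
  rw [det_fderivPolarCoordSymm, abs_of_pos hp.1, smul_eq_mul]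

theorem integral_eq_polar (F : ℝ × ℝ → ℝ) (c : ℝ × ℝ) :
    ∫ p, F p = ∫ p in Ioi 0 ×ˢ Ioo (-Real.pi) Real.pi, p.1 * F (polarCoord.symm p + c) := by
  rw [← integral_add_right_eq_self F c, ← integral_comp_polarCoord_symm, polarCoord_target]
  rfl

theorem integrable_iff_polar (F : ℝ × ℝ → ℝ) (c : ℝ × ℝ) :
    IntegrableOn (fun p : ℝ × ℝ => p.1 * F (polarCoord.symm p + c))
      (Ioi 0 ×ˢ Ioo (-Real.pi) Real.pi) ↔ Integrable F := by
  rw [integrableOn_comp_polarCoord_symm (F := fun p => F (p + c))]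
  exact (measurePreserving_add_right volume c).integrable_comp_emb
    (MeasurableEquiv.addRight c).measurableEmbedding

theorem euclDist_polar {r : ℝ} (hr : 0 < r) (θ : ℝ) (c : ℝ × ℝ) :
    euclDist (polarCoord.symm (r, θ) + c) c = r := by
  rw [euclDist]
  refine (congrArg _ ?_).trans (Real.sqrt_sq hr.le)
  simp only [polarCoord_symm_apply, Prod.fst_add, Prod.snd_add, add_sub_cancel_right]
  linear_combination r ^ 2 * Real.sin_sq_add_cos_sq θ

/-- The angle is the argument of the difference viewed as a complex number; when the points coincide
any angle works. -/
theorem exists_angle (c₁ c₂ : ℝ × ℝ) : ∃ θ₀ : ℝ,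
    c₂.1 - c₁.1 = euclDist c₂ c₁ * Real.cos θ₀ ∧ c₂.2 - c₁.2 = euclDist c₂ c₁ * Real.sin θ₀ := by
  set z : ℂ := ⟨c₂.1 - c₁.1, c₂.2 - c₁.2⟩ with hz
  have hn : ‖z‖ = euclDist c₂ c₁ := by
    rw [Complex.norm_eq_sqrt_sq_add_sq, euclDist]
  refine ⟨z.arg, ?_, ?_⟩
  · rw [← hn, Complex.norm_mul_cos_arg]
  · rw [← hn, Complex.norm_mul_sin_arg]

theorem integrable_radial {g : ℝ → ℝ} (hg : IntegrableOn (fun r => r * g r) (Ioi 0)) (c : ℝ × ℝ) :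
    Integrable fun p => g (euclDist p c) := by
  rw [← integrable_iff_polar _ c]
  have h1 : IntegrableOn (fun _ : ℝ => (1 : ℝ)) (Ioo (-Real.pi) Real.pi) := by simp
  have h := Integrable.mul_prod hg h1
  rw [Measure.prod_restrict] at h
  refine IntegrableOn.congr_fun h (fun p hp => ?_) (measurableSet_Ioi.prod measurableSet_Ioo)
  obtain ⟨r, θ⟩ := p
  simp only [mul_one]
  rw [euclDist_polar hp.1]

theorem integral_radial (g : ℝ → ℝ) (c : ℝ × ℝ) :
    ∫ p, g (euclDist p c) = 2 * Real.pi * ∫ r in Ioi 0, r * g r := by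
  rw [integral_eq_polar _ c]
  have h := setIntegral_prod_mul (μ := volume) (ν := volume) (fun r : ℝ => r * g r)
    (fun _ : ℝ => (1 : ℝ)) (Ioi 0) (Ioo (-Real.pi) Real.pi)
  have h2 : ∫ _ in Ioo (-Real.pi) Real.pi, (1 : ℝ) = 2 * Real.pi := by
    simp [Real.pi_pos.le]; ring
  rw [h2, mul_comm _ (2 * Real.pi)] at h
  rw [← h]
  refine setIntegral_congr_fun (measurableSet_Ioi.prod measurableSet_Ioo) fun p hp => ?_
  obtain ⟨r, θ⟩ := p
  simp only [mul_one]
  rw [euclDist_polar hp.1]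

/-- Periodicity removes the direction of the second centre, leaving only its distance. -/
theorem integral_kernelSq_shift (Γ d r θ₀ : ℝ) :
    ∫ θ in Ioo (-Real.pi) Real.pi, kernelSq Γ (d ^ 2 + r ^ 2 - 2 * d * r * Real.cos (θ - θ₀))
      = circleIntegralK Γ d r := by
  rw [← integral_Ioc_eq_integral_Ioo,
    ← intervalIntegral.integral_of_le (by linarith [Real.pi_pos]),
    intervalIntegral.integral_comp_sub_right
      (fun θ => kernelSq Γ (d ^ 2 + r ^ 2 - 2 * d * r * Real.cos θ)) θ₀, circleIntegralK]
  have hp : Function.Periodic (fun θ => kernelSq Γ (d ^ 2 + r ^ 2 - 2 * d * r * Real.cos θ))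
      (2 * Real.pi) := fun θ => by simp only [Real.cos_add_two_pi]
  have h := hp.intervalIntegral_add_eq (-Real.pi - θ₀) (-Real.pi)
  convert h using 2 <;> ring

theorem euclDist_polar_other {r : ℝ} {c₁ c₂ : ℝ × ℝ} {d θ₀ : ℝ}
    (h1 : c₂.1 - c₁.1 = d * Real.cos θ₀) (h2 : c₂.2 - c₁.2 = d * Real.sin θ₀) (θ : ℝ) :
    euclDist (polarCoord.symm (r, θ) + c₁) c₂
      = √(d ^ 2 + r ^ 2 - 2 * d * r * Real.cos (θ - θ₀)) := by
  rw [euclDist]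
  congr 1
  simp only [polarCoord_symm_apply, Prod.fst_add, Prod.snd_add]
  rw [show r * Real.cos θ + c₁.1 - c₂.1 = r * Real.cos θ - d * Real.cos θ₀ by linarith,
    show r * Real.sin θ + c₁.2 - c₂.2 = r * Real.sin θ - d * Real.sin θ₀ by linarith, Real.cos_sub]
  linear_combination r ^ 2 * Real.sin_sq_add_cos_sq θ + d ^ 2 * Real.sin_sq_add_cos_sq θ₀

/-- Integral of a radial function against `K₀(Γ |p - c₂|)`. -/
theorem integral_radial_mul_besselK {Γ : ℝ} (hΓ : 0 < Γ) {g : ℝ → ℝ} {c₁ c₂ : ℝ × ℝ}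
    (hd : 0 < euclDist c₂ c₁)
    (hint : Integrable fun p => g (euclDist p c₁) * besselK 0 (Γ * euclDist p c₂)) :
    IntegrableOn (fun r => r * g r * radialGreen Γ (euclDist c₂ c₁) r) (Ioi 0) ∧
    ∫ p, g (euclDist p c₁) * besselK 0 (Γ * euclDist p c₂)
      = 2 * Real.pi * ∫ r in Ioi 0, r * g r * radialGreen Γ (euclDist c₂ c₁) r := by
  obtain ⟨θ₀, h1, h2⟩ := exists_angle c₁ c₂
  set d := euclDist c₂ c₁
  have hcongr : EqOn (fun p : ℝ × ℝ => p.1 * (g (euclDist (polarCoord.symm p + c₁) c₁)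
        * besselK 0 (Γ * euclDist (polarCoord.symm p + c₁) c₂)))
      (fun p => p.1 * g p.1 * kernelSq Γ (d ^ 2 + p.1 ^ 2 - 2 * d * p.1 * Real.cos (p.2 - θ₀)))
      (Ioi 0 ×ˢ Ioo (-Real.pi) Real.pi) := by
    rintro ⟨r, θ⟩ hp
    simp only
    rw [euclDist_polar hp.1, euclDist_polar_other h1 h2, kernelSq]
    ring
  have hmeas : MeasurableSet (Ioi (0 : ℝ) ×ˢ Ioo (-Real.pi) Real.pi) :=
    measurableSet_Ioi.prod measurableSet_Ioo
  rw [← integrable_iff_polar _ c₁, integrableOn_congr_fun hcongr hmeas] at hint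
  have hinner : ∀ r : ℝ, ∫ θ in Ioo (-Real.pi) Real.pi, r * g r
      * kernelSq Γ (d ^ 2 + r ^ 2 - 2 * d * r * Real.cos (θ - θ₀))
      = r * g r * circleIntegralK Γ d r := fun r => by
    rw [integral_const_mul, integral_kernelSq_shift]
  have hae : (fun r => r * g r * circleIntegralK Γ d r) =ᵐ[volume.restrict (Ioi 0)]
      fun r => 2 * Real.pi * (r * g r * radialGreen Γ d r) := by
    -- At `r = d` the circle passes through the singularity of the kernel, and the mean value
    -- formula is not available; this single radius is negligible.
    have hne : ∀ᵐ r ∂(volume.restrict (Ioi (0 : ℝ))), r ≠ d :=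
      ae_restrict_of_ae (by simp [ae_iff])
    filter_upwards [hne, ae_restrict_mem measurableSet_Ioi] with r hr hr0
    rw [circleIntegralK_eq_radialGreen hΓ hd hr0 hr]
    ring
  constructor
  · have hint' := hint
    rw [IntegrableOn, Measure.volume_eq_prod, ← Measure.prod_restrict] at hint'
    have h := hint'.integral_prod_left
    simp only [hinner] at h
    have h3 := (h.congr hae).const_mul (2 * Real.pi)⁻¹
    refine h3.congr (ae_of_all _ fun r => ?_)
    have := Real.pi_pos
    field_simp
  · rw [integral_eq_polar _ c₁, setIntegral_congr_fun hmeas hcongr, Measure.volume_eq_prod,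
      setIntegral_prod _ hint]
    simp only [hinner]
    rw [integral_congr_ae hae, integral_const_mul]

/-! ### Radial profile of a mode -/

open Classical in
/-- `A J₀(Λ r)` for `r < a` and `B K₀(Γ r)` for `r ≥ a`. -/
noncomputable def coreProfile (a A B Λ Γ r : ℝ) : ℝ :=
  if r < a then A * besselJ 0 (Λ * r) else B * besselK 0 (Γ * r)

theorem coreMode_eq (a Λ Γ : ℝ) (c p : ℝ × ℝ) :
    coreMode a Λ Γ c p = coreProfile a (ampA a Λ Γ) (ampB a Λ Γ) Λ Γ (euclDist p c) := rfl

section Profile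

variable {a A B Λ Γ r : ℝ}

theorem coreProfile_of_lt (h : r < a) : coreProfile a A B Λ Γ r = A * besselJ 0 (Λ * r) :=
  if_pos h

theorem coreProfile_of_le (h : a ≤ r) : coreProfile a A B Λ Γ r = B * besselK 0 (Γ * r) :=
  if_neg (not_lt.2 h)

theorem integrableOn_mul_coreProfile (ha : 0 < a) (hΓ : 0 < Γ) :
    IntegrableOn (fun r => r * coreProfile a A B Λ Γ r) (Ioi 0) := by
  rw [← Ioo_union_Ici_eq_Ioi ha]
  refine IntegrableOn.union ?_ ?_
  · have hc : Continuous fun r => r * (A * besselJ 0 (Λ * r)) :=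
      continuous_id.mul (continuous_const.mul (continuous_besselJ_zero_mul Λ))
    refine (hc.integrableOn_Icc.mono_set Ioo_subset_Icc_self).congr_fun (fun r hr => ?_)
      measurableSet_Ioo
    simp only [coreProfile_of_lt hr.2]
  · have h := ((integrableOn_mul_besselK_zero hΓ).mono_set
      (show Ici a ⊆ Ioi 0 from fun r hr => ha.trans_le hr)).const_mul B
    refine IntegrableOn.congr_fun h (fun r hr => ?_) measurableSet_Ici
    simp only [coreProfile_of_le (show a ≤ r from hr)]
    ring

theorem exists_bound_coreProfile (a A B Λ Γ : ℝ) (ha : 0 < a) (hΓ : 0 < Γ) :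
    ∃ C, ∀ r, 0 ≤ r → ‖coreProfile a A B Λ Γ r‖ ≤ C := by
  obtain ⟨C, hC⟩ := isCompact_Icc (a := (0 : ℝ)) (b := a) |>.exists_bound_of_continuousOn
    (continuous_const.mul (continuous_besselJ_zero_mul Λ) : Continuous
      fun r => A * besselJ 0 (Λ * r)).continuousOn
  refine ⟨max C (|B| * besselK 0 (Γ * a)), fun r hr => ?_⟩
  rcases lt_or_ge r a with h | h
  · rw [coreProfile_of_lt h]
    exact (hC r ⟨hr, h.le⟩).trans (le_max_left _ _)
  · rw [coreProfile_of_le h, norm_mul, Real.norm_eq_abs, Real.norm_eq_abs,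
      abs_of_pos (besselK_zero_pos (mul_pos hΓ (ha.trans_le h)))]
    refine le_trans ?_ (le_max_right _ _)
    gcongr
    exact besselK_zero_antitone (mul_pos hΓ ha) (by gcongr)

end Profile

theorem integral_mul_coreProfile_sq {a A B Λ Γ : ℝ} (ha : 0 < a) (hΛ : Λ ≠ 0) (hΓ : 0 < Γ) :
    ∫ r in Ioi 0, r * (coreProfile a A B Λ Γ r * coreProfile a A B Λ Γ r) =
      A ^ 2 * (a ^ 2 / 2 * (besselJ 1 (Λ * a) ^ 2 + besselJ 0 (Λ * a) ^ 2))
      + B ^ 2 * (a ^ 2 / 2 * (besselK 1 (Γ * a) ^ 2 - besselK 0 (Γ * a) ^ 2)) := by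
  have hJ := continuous_besselJ_zero_mul Λ
  have h1 : EqOn (fun r => A ^ 2 * (r * besselJ 0 (Λ * r) * besselJ 0 (Λ * r)))
      (fun r => r * (coreProfile a A B Λ Γ r * coreProfile a A B Λ Γ r)) (Ioo 0 a) := by
    intro r hr
    simp only [coreProfile_of_lt hr.2]
    ring
  have h2 : EqOn (fun r => B ^ 2 * (r * besselK 0 (Γ * r) * besselK 0 (Γ * r)))
      (fun r => r * (coreProfile a A B Λ Γ r * coreProfile a A B Λ Γ r)) (Ioi a) := by
    intro r hr
    simp only [coreProfile_of_le (le_of_lt hr)]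
    ring
  have hc : Continuous fun r => A ^ 2 * (r * besselJ 0 (Λ * r) * besselJ 0 (Λ * r)) :=
    continuous_const.mul ((continuous_id.mul hJ).mul hJ)
  have hi1 : IntervalIntegrable (fun r => r * (coreProfile a A B Λ Γ r * coreProfile a A B Λ Γ r))
      volume 0 a := by
    rw [intervalIntegrable_iff_integrableOn_Ioo_of_le ha.le]
    exact (hc.integrableOn_Icc.mono_set Ioo_subset_Icc_self).congr_fun h1 measurableSet_Ioo
  have hi2 : IntegrableOn (fun r => r * (coreProfile a A B Λ Γ r * coreProfile a A B Λ Γ r))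
      (Ioi a) :=
    IntegrableOn.congr_fun ((integrableOn_mul_K_K hΓ hΓ ha).const_mul _) h2 measurableSet_Ioi
  rw [← intervalIntegral.integral_interval_add_Ioi' hi1 hi2,
    ← intervalIntegral.integral_congr_Ioo_of_le ha.le h1,
    ← setIntegral_congr_fun measurableSet_Ioi h2, intervalIntegral.integral_const_mul,
    integral_const_mul, integral_mul_J_J hΛ ha, integral_Ioi_mul_K_K_self hΓ ha]

theorem integral_coreMode_mul_self {a Λ Γ : ℝ} (ha : 0 < a) (hΛ : Λ ≠ 0) (hΓ : 0 < Γ)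
    (hJ : besselJ 0 (Λ * a) ≠ 0) (c : ℝ × ℝ) :
    ∫ p, coreMode a Λ Γ c p * coreMode a Λ Γ c p = 1 := by
  simp only [coreMode_eq]
  rw [integral_radial (fun r => coreProfile a (ampA a Λ Γ) (ampB a Λ Γ) Λ Γ r
    * coreProfile a (ampA a Λ Γ) (ampB a Λ Γ) Λ Γ r) c, integral_mul_coreProfile_sq ha hΛ hΓ]
  set X := Real.pi * a ^ 2 * (besselJ 1 (Λ * a) ^ 2 + besselJ 0 (Λ * a) ^ 2)
    + Real.pi * a ^ 2 * (besselJ 0 (Λ * a) / besselK 0 (Γ * a)) ^ 2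
      * (besselK 1 (Γ * a) ^ 2 - besselK 0 (Γ * a) ^ 2) with hX
  have hK := besselK_zero_pos (mul_pos hΓ ha)
  have hK1 := besselK_zero_le_one (mul_pos hΓ ha)
  -- Positivity comes from `J₀(Λa) ≠ 0` and `K₀ ≤ K₁`; it is needed for the real power `-1/2` to be
  -- the inverse square root.
  have hXpos : 0 < X := by
    have h1 : 0 < besselJ 0 (Λ * a) ^ 2 := by positivity
    have h2 : 0 ≤ besselK 1 (Γ * a) ^ 2 - besselK 0 (Γ * a) ^ 2 := by nlinarith
    have := Real.pi_pos
    positivity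
  have hA : ampA a Λ Γ ^ 2 * X = 1 := by
    have : ampA a Λ Γ = X ^ (-(1 / 2) : ℝ) := rfl
    rw [this, pow_two, ← Real.rpow_add hXpos]
    norm_num
    rw [Real.rpow_neg_one, inv_mul_cancel₀ hXpos.ne']
  rw [← hA, ampB, hX]
  ring

/-! ### Overlap of two modes -/

theorem integrable_coreProfile {a A B Λ Γ : ℝ} (ha : 0 < a) (hΓ : 0 < Γ) (c : ℝ × ℝ) :
    Integrable fun p => coreProfile a A B Λ Γ (euclDist p c) :=
  integrable_radial (integrableOn_mul_coreProfile ha hΓ) c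

theorem euclDist_nonneg (p c : ℝ × ℝ) : 0 ≤ euclDist p c := Real.sqrt_nonneg _

theorem integrable_mul_coreProfile {a A B Λ Γ : ℝ} (ha : 0 < a) (hΓ : 0 < Γ) (c : ℝ × ℝ)
    {f : ℝ × ℝ → ℝ} (hf : Integrable f) :
    Integrable fun p => f p * coreProfile a A B Λ Γ (euclDist p c) := by
  obtain ⟨C, hC⟩ := exists_bound_coreProfile a A B Λ Γ ha hΓ
  exact hf.mul_bdd (integrable_coreProfile ha hΓ c).aestronglyMeasurable
    (ae_of_all _ fun p => hC _ (euclDist_nonneg p c))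

theorem integrable_coreMode_mul {a Λ₁ Γ₁ Λ₂ Γ₂ : ℝ} (ha : 0 < a) (hΓ₁ : 0 < Γ₁) (hΓ₂ : 0 < Γ₂)
    (c₁ c₂ : ℝ × ℝ) : Integrable fun p => coreMode a Λ₁ Γ₁ c₁ p * coreMode a Λ₂ Γ₂ c₂ p :=
  integrable_mul_coreProfile ha hΓ₂ c₂ (integrable_coreProfile ha hΓ₁ c₁)

theorem euclDist_eq_dist (p c : ℝ × ℝ) : euclDist p c = dist (⟨p.1, p.2⟩ : ℂ) ⟨c.1, c.2⟩ := by
  rw [Complex.dist_eq_re_im, euclDist]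

theorem euclDist_comm (p c : ℝ × ℝ) : euclDist p c = euclDist c p := by
  rw [euclDist_eq_dist, euclDist_eq_dist, dist_comm]

theorem euclDist_triangle (p q c : ℝ × ℝ) : euclDist p c ≤ euclDist p q + euclDist q c := by
  simp only [euclDist_eq_dist]
  exact dist_triangle _ _ _

section Overlap

variable {a A₁ B₁ Λ₁ Γ₁ A₂ B₂ Λ₂ Γ₂ d : ℝ}

theorem setIntegral_coreProfile_mul_radialGreen (ha : 0 < a) (had : a ≤ d)
    (hint : IntegrableOn (fun r => r * coreProfile a A₁ B₁ Λ₁ Γ₁ r * radialGreen Γ₂ d r) (Ioi 0)) :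
    ∫ r in Ioi 0, r * coreProfile a A₁ B₁ Λ₁ Γ₁ r * radialGreen Γ₂ d r =
      A₁ * besselK 0 (Γ₂ * d) * (∫ r in (0)..a, r * besselJ 0 (Λ₁ * r) * besselI 0 (Γ₂ * r))
      + B₁ * besselK 0 (Γ₂ * d) * (∫ r in a..d, r * besselK 0 (Γ₁ * r) * besselI 0 (Γ₂ * r))
      + B₁ * besselI 0 (Γ₂ * d)
        * ∫ r in Ioi d, r * besselK 0 (Γ₁ * r) * besselK 0 (Γ₂ * r) := by
  have hd := ha.trans_le had
  have hia := hint.mono_set (Ioi_subset_Ioi ha.le)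
  have hid := hint.mono_set (Ioi_subset_Ioi hd.le)
  rw [← intervalIntegral.integral_interval_add_Ioi hint hia,
    ← intervalIntegral.integral_interval_add_Ioi hia hid, ← add_assoc,
    ← intervalIntegral.integral_const_mul, ← intervalIntegral.integral_const_mul,
    ← integral_const_mul]
  congr 1
  · congr 1
    · refine intervalIntegral.integral_congr_Ioo_of_le ha.le fun r hr => ?_
      simp only [coreProfile_of_lt hr.2, radialGreen, if_pos (hr.2.trans_le had)]
      ring
    · refine intervalIntegral.integral_congr_Ioo_of_le had fun r hr => ?_
      simp only [coreProfile_of_le hr.1.le, radialGreen, if_pos hr.2]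
      ring
  · refine setIntegral_congr_fun measurableSet_Ioi fun r hr => ?_
    have hr' : d < r := hr
    simp only [coreProfile_of_le (had.trans hr'.le), radialGreen, if_neg (not_lt.2 hr'.le)]
    ring

/-- The defect vanishes for `r ≥ a`, and since `a ≤ d` only the inner branch of the Green function
is seen. -/
theorem setIntegral_defect_mul_radialGreen (ha : 0 < a) (had : a ≤ d) (hΓ₂ : 0 < Γ₂) :
    ∫ r in Ioi 0, r * (coreProfile a A₂ B₂ Λ₂ Γ₂ r - B₂ * besselK 0 (Γ₂ * r))
        * radialGreen Γ₁ d r =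
      besselK 0 (Γ₁ * d) *
        (A₂ * (∫ r in (0)..a, r * besselJ 0 (Λ₂ * r) * besselI 0 (Γ₁ * r))
        - B₂ * ∫ r in (0)..a, r * besselK 0 (Γ₂ * r) * besselI 0 (Γ₁ * r)) := by
  have hJ := continuous_besselJ_zero_mul Λ₂
  have hI := continuous_besselI_zero_mul Γ₁
  have hiJ : IntervalIntegrable (fun r => A₂ * (r * besselJ 0 (Λ₂ * r) * besselI 0 (Γ₁ * r)))
      volume 0 a :=
    (continuous_const.mul ((continuous_id.mul hJ).mul hI)).intervalIntegrable _ _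
  have hiK := (intervalIntegrable_mul_K_I Γ₁ hΓ₂ le_rfl ha.le).const_mul B₂
  rw [← intervalIntegral.integral_const_mul, ← intervalIntegral.integral_const_mul,
    ← intervalIntegral.integral_sub hiJ hiK, ← intervalIntegral.integral_const_mul,
    intervalIntegral.integral_of_le ha.le, integral_Ioc_eq_integral_Ioo]
  rw [setIntegral_eq_of_subset_of_forall_sdiff_eq_zero measurableSet_Ioi
    (show Ioo 0 a ⊆ Ioi 0 from fun r hr => hr.1)]
  · refine setIntegral_congr_fun measurableSet_Ioo fun r hr => ?_
    simp only [coreProfile_of_lt hr.2, radialGreen, if_pos (hr.2.trans_le had)]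
    ring
  · intro r hr
    have hr' : a ≤ r := not_lt.1 fun h => hr.2 ⟨hr.1, h⟩
    rw [coreProfile_of_le hr', sub_self, mul_zero, zero_mul]

/-- Subtracting `B₂ K₀` from the second profile leaves a defect supported in the second core. There
the first profile is its exterior expression, so both pieces are radial functions tested against a
single `K₀`, and the mean value formula applies to each. -/
theorem integral_coreProfile_mul_coreProfile (ha : 0 < a) (hΓ₁ : 0 < Γ₁) (hΓ₂ : 0 < Γ₂)
    {c₁ c₂ : ℝ × ℝ} (hc : euclDist c₂ c₁ = d) (hd : 2 * a ≤ d) :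
    ∫ p, coreProfile a A₁ B₁ Λ₁ Γ₁ (euclDist p c₁) * coreProfile a A₂ B₂ Λ₂ Γ₂ (euclDist p c₂) =
      2 * Real.pi * (B₂ * (A₁ * besselK 0 (Γ₂ * d)
          * (∫ r in (0)..a, r * besselJ 0 (Λ₁ * r) * besselI 0 (Γ₂ * r))
        + B₁ * (besselK 0 (Γ₂ * d)
            * (∫ r in a..d, r * besselK 0 (Γ₁ * r) * besselI 0 (Γ₂ * r))
          + besselI 0 (Γ₂ * d) * ∫ r in Ioi d, r * besselK 0 (Γ₁ * r) * besselK 0 (Γ₂ * r)))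
      + B₁ * (besselK 0 (Γ₁ * d) *
        (A₂ * (∫ r in (0)..a, r * besselJ 0 (Λ₂ * r) * besselI 0 (Γ₁ * r))
        - B₂ * ∫ r in (0)..a, r * besselK 0 (Γ₂ * r) * besselI 0 (Γ₁ * r)))) := by
  have had : a ≤ d := by linarith
  have hd0 : 0 < d := by linarith
  set φ₁ := coreProfile a A₁ B₁ Λ₁ Γ₁ with hφ₁
  set φ₂ := coreProfile a A₂ B₂ Λ₂ Γ₂ with hφ₂
  set h₂ : ℝ → ℝ := fun r => φ₂ r - B₂ * besselK 0 (Γ₂ * r) with hh₂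
  have hKint : Integrable fun p => besselK 0 (Γ₂ * euclDist p c₂) :=
    integrable_radial (g := fun r => besselK 0 (Γ₂ * r)) (integrableOn_mul_besselK_zero hΓ₂) c₂
  have hint₁ : Integrable fun p => φ₁ (euclDist p c₁) * besselK 0 (Γ₂ * euclDist p c₂) := by
    simpa only [mul_comm] using integrable_mul_coreProfile (A := A₁) (B := B₁) (Λ := Λ₁)
      ha hΓ₁ c₁ hKint
  have hint₂ : Integrable fun p => h₂ (euclDist p c₂) * φ₁ (euclDist p c₁) :=
    integrable_mul_coreProfile ha hΓ₁ c₁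
      ((integrable_coreProfile ha hΓ₂ c₂).sub (hKint.const_mul B₂))
  have hsupp : ∀ p, h₂ (euclDist p c₂) * φ₁ (euclDist p c₁) =
      (B₁ * h₂ (euclDist p c₂)) * besselK 0 (Γ₁ * euclDist p c₁) := by
    intro p
    rcases lt_or_ge (euclDist p c₂) a with h | h
    · have htri := euclDist_triangle c₂ p c₁
      rw [hc, euclDist_comm c₂ p] at htri
      rw [hφ₁, coreProfile_of_le (by linarith)]
      ring
    · have : h₂ (euclDist p c₂) = 0 := by
        simp only [hh₂, hφ₂, coreProfile_of_le h, sub_self]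
      rw [this]; ring
  have hR₁ := integral_radial_mul_besselK (g := φ₁) hΓ₂ (by rw [hc]; exact hd0) hint₁
  have hR₂ := integral_radial_mul_besselK (g := fun r => B₁ * h₂ r) (c₁ := c₂) (c₂ := c₁) hΓ₁
    (by rw [euclDist_comm, hc]; exact hd0) (hint₂.congr (ae_of_all _ hsupp))
  rw [hc] at hR₁
  rw [euclDist_comm, hc] at hR₂
  have hsplit : ∀ p, φ₁ (euclDist p c₁) * φ₂ (euclDist p c₂) =
      B₂ * (φ₁ (euclDist p c₁) * besselK 0 (Γ₂ * euclDist p c₂))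
        + h₂ (euclDist p c₂) * φ₁ (euclDist p c₁) := by
    intro p; simp only [hh₂]; ring
  simp only [hsplit]
  rw [integral_add (hint₁.const_mul B₂) hint₂, integral_const_mul]
  simp only [hsupp]
  rw [hR₁.2, hR₂.2, setIntegral_coreProfile_mul_radialGreen ha had hR₁.1]
  have hB : (fun r => r * (B₁ * h₂ r) * radialGreen Γ₁ d r)
      = fun r => B₁ * (r * h₂ r * radialGreen Γ₁ d r) := by funext r; ring
  rw [hB, integral_const_mul, setIntegral_defect_mul_radialGreen ha had hΓ₂]
  ring

theorem integral_J_I_eq (Λ Γ : ℝ) (hΓ : 0 < Γ) (ha : 0 < a) :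
    ∫ r in (0)..a, r * besselJ 0 (Λ * r) * besselI 0 (Γ * r) =
      a / (Λ ^ 2 + Γ ^ 2) * (Λ * besselI 0 (Γ * a) * besselJ 1 (Λ * a)
        + Γ * besselJ 0 (Λ * a) * besselI 1 (Γ * a)) := by
  have h := integral_mul_J_I Λ Γ ha
  have hne : Λ ^ 2 + Γ ^ 2 ≠ 0 := by positivity
  rw [div_mul_eq_mul_div, eq_div_iff hne]
  linarith

theorem overlap_of_ne (ha : 0 < a) (hΓ₁ : 0 < Γ₁) (hΓ₂ : 0 < Γ₂) (hne : Γ₂ ^ 2 - Γ₁ ^ 2 ≠ 0)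
    {c₁ c₂ : ℝ × ℝ} (hc : euclDist c₂ c₁ = d) (hd : 2 * a ≤ d) :
    ∫ p, coreProfile a A₁ B₁ Λ₁ Γ₁ (euclDist p c₁) * coreProfile a A₂ B₂ Λ₂ Γ₂ (euclDist p c₂) =
      2 * Real.pi * A₂ * B₁ * besselK 0 (Γ₁ * d) * (a / (Λ₂ ^ 2 + Γ₁ ^ 2))
          * (Λ₂ * besselI 0 (Γ₁ * a) * besselJ 1 (Λ₂ * a)
            + Γ₁ * besselJ 0 (Λ₂ * a) * besselI 1 (Γ₁ * a))
        + 2 * Real.pi * A₁ * B₂ * besselK 0 (Γ₂ * d) * (a / (Λ₁ ^ 2 + Γ₂ ^ 2))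
          * (Λ₁ * besselI 0 (Γ₂ * a) * besselJ 1 (Λ₁ * a)
            + Γ₂ * besselJ 0 (Λ₁ * a) * besselI 1 (Γ₂ * a))
        + 2 * Real.pi * B₁ * B₂ * a / (Γ₂ ^ 2 - Γ₁ ^ 2)
          * (besselK 0 (Γ₁ * d)
              * (Γ₂ * besselI 0 (Γ₁ * a) * besselK 1 (Γ₂ * a)
                + Γ₁ * besselI 1 (Γ₁ * a) * besselK 0 (Γ₂ * a))
            - besselK 0 (Γ₂ * d)
              * (Γ₁ * besselI 0 (Γ₂ * a) * besselK 1 (Γ₁ * a)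
                + Γ₂ * besselI 1 (Γ₂ * a) * besselK 0 (Γ₁ * a))) := by
  have had : a ≤ d := by linarith
  have hd0 : 0 < d := by linarith
  rw [integral_coreProfile_mul_coreProfile ha hΓ₁ hΓ₂ hc hd, integral_J_I_eq Λ₁ Γ₂ hΓ₂ ha,
    integral_J_I_eq Λ₂ Γ₁ hΓ₁ ha]
  have hin := integral_zero_mul_K_I (Γ₂ := Γ₁) hΓ₂ ha
  have hmid := integral_mul_K_I (Γ₂ := Γ₂) hΓ₁ ha had
  have hout := integral_Ioi_mul_K_K hΓ₁ hΓ₂ hd0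
  have hw := wronskianKI_self hΓ₂ hd0
  -- The boundary terms at `d` from the middle and outer integrals combine to `K₀(Γ₁d)` times the
  -- Wronskian of `K₀(Γ₂r)` and `I₀(Γ₂r)`, which is `1`. They cancel the `-1` produced at `r = 0` by
  -- the inner integral, and only the values at `a` survive.
  have key : (Γ₂ ^ 2 - Γ₁ ^ 2) * (besselK 0 (Γ₂ * d)
        * (∫ r in a..d, r * besselK 0 (Γ₁ * r) * besselI 0 (Γ₂ * r))
      + besselI 0 (Γ₂ * d) * (∫ r in Ioi d, r * besselK 0 (Γ₁ * r) * besselK 0 (Γ₂ * r))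
      - besselK 0 (Γ₁ * d) * ∫ r in (0)..a, r * besselK 0 (Γ₂ * r) * besselI 0 (Γ₁ * r)) =
      a * (besselK 0 (Γ₁ * d)
              * (Γ₂ * besselI 0 (Γ₁ * a) * besselK 1 (Γ₂ * a)
                + Γ₁ * besselI 1 (Γ₁ * a) * besselK 0 (Γ₂ * a))
            - besselK 0 (Γ₂ * d)
              * (Γ₁ * besselI 0 (Γ₂ * a) * besselK 1 (Γ₁ * a)
                + Γ₂ * besselI 1 (Γ₂ * a) * besselK 0 (Γ₁ * a))) := by
    simp only [wronskianKI] at hin hmid hw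
    linear_combination besselK 0 (Γ₂ * d) * hmid + besselI 0 (Γ₂ * d) * hout
      + besselK 0 (Γ₁ * d) * hin + besselK 0 (Γ₁ * d) * hw
  rw [mul_comm, ← eq_div_iff hne] at key
  linear_combination 2 * Real.pi * B₁ * B₂ * key

end Overlap

theorem overlap_of_eq {a A B Λ Γ d : ℝ} (ha : 0 < a) (hΓ : 0 < Γ)
    {c₁ c₂ : ℝ × ℝ} (hc : euclDist c₂ c₁ = d) (hd : 2 * a ≤ d) :
    ∫ p, coreProfile a A B Λ Γ (euclDist p c₁) * coreProfile a A B Λ Γ (euclDist p c₂) =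
      4 * a * Real.pi * A * B * besselK 0 (Γ * d) / (Γ ^ 2 + Λ ^ 2)
          * (Λ * besselI 0 (Γ * a) * besselJ 1 (Λ * a)
            + Γ * besselJ 0 (Λ * a) * besselI 1 (Γ * a))
        + Real.pi * B ^ 2 * d * besselK 1 (Γ * d) / Γ
        - 2 * Real.pi * B ^ 2 * a ^ 2 * besselK 0 (Γ * d)
          * (besselI 0 (Γ * a) * besselK 0 (Γ * a)
            + besselI 1 (Γ * a) * besselK 1 (Γ * a)) := by
  have had : a ≤ d := by linarith
  have hd0 : 0 < d := by linarith
  rw [integral_coreProfile_mul_coreProfile ha hΓ hΓ hc hd, integral_J_I_eq Λ Γ hΓ ha,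
    integral_zero_mul_K_I_self hΓ ha, integral_mul_K_I_self hΓ ha had,
    integral_Ioi_mul_K_K_self hΓ hd0, add_comm (Λ ^ 2)]
  have hw := wronskianKI_self hΓ hd0
  -- Multiplying by the Wronskian, equal to `1`, turns the compact `d K₁(Γd)/Γ` into the products of
  -- `I` and `K` left by the energy terms at `d`.
  have hdiv : d * besselK 1 (Γ * d) / Γ = d * besselK 1 (Γ * d) / Γ * wronskianKI Γ Γ d := by
    rw [hw, mul_one]
  have hdiv' : d * besselK 1 (Γ * d) / Γ = d ^ 2 * besselK 1 (Γ * d)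
      * (besselK 0 (Γ * d) * besselI 1 (Γ * d) + besselI 0 (Γ * d) * besselK 1 (Γ * d)) := by
    rw [hdiv, wronskianKI]
    field_simp
    ring
  simp only [energyKI]
  linear_combination (-Real.pi * B ^ 2) * hdiv'

/-! ### Monotonicity of the dispersion relation -/

/-- Equal decay rates would make the right-hand sides of the two characteristic equations equal,
while the larger index step has the larger `Λ`. This contradicts strict monotonicity of `x
J₁(x)/J₀(x)`, whose derivative `x (J₀² + J₁²)/J₀²` is positive before the first zero of `J₀`. -/
theorem coreGamma_sq_ne {a n₀ lam δ₁ δ₂ β₁ β₂ : ℝ} (ha : 0 < a) (hn : 0 < n₀) (hlam : 0 < lam)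
    (hδ : δ₁ < δ₂) (h₁ : IsFundamentalShift a n₀ lam δ₁ β₁)
    (h₂ : IsFundamentalShift a n₀ lam δ₂ β₂) :
    coreGamma n₀ lam β₁ ^ 2 ≠ coreGamma n₀ lam β₂ ^ 2 := by
  intro heq
  have hnn : ∀ β, 0 < β → 0 ≤ 4 * Real.pi * n₀ * β / lam := fun β hβ => by positivity
  have hΓ : coreGamma n₀ lam β₁ = coreGamma n₀ lam β₂ :=
    (sq_eq_sq₀ (Real.sqrt_nonneg _) (Real.sqrt_nonneg _)).1 heq
  have hβ : 4 * Real.pi * n₀ * β₁ / lam = 4 * Real.pi * n₀ * β₂ / lam := by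
    rwa [coreGamma, coreGamma, Real.sq_sqrt (hnn _ h₁.shift_pos),
      Real.sq_sqrt (hnn _ h₂.shift_pos)] at heq
  have hΛ : coreLambda n₀ lam δ₁ β₁ < coreLambda n₀ lam δ₂ β₂ := by
    refine Real.sqrt_lt_sqrt h₁.lambdaSq_pos.le ?_
    rw [lambdaSq, lambdaSq, hβ]
    gcongr
  have hchar := h₁.char_eq.trans ((by rw [hΓ]) : _ = _) |>.trans h₂.char_eq.symm
  have hΛ₁ : 0 < coreLambda n₀ lam δ₁ β₁ := Real.sqrt_pos.2 h₁.lambdaSq_pos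
  have hne := h₂.before_first_zero
  set Λ₁ := coreLambda n₀ lam δ₁ β₁
  set Λ₂ := coreLambda n₀ lam δ₂ β₂
  have hlt : Λ₁ * a < Λ₂ * a := by gcongr
  have h0 : 0 < Λ₁ * a := by positivity
  have hder : ∀ x, 0 < x → x ≤ Λ₂ * a →
      HasDerivAt (fun x => x * besselJ 1 x / besselJ 0 x)
        ((x * besselJ 0 x * besselJ 0 x - x * besselJ 1 x * -besselJ 1 x) / besselJ 0 x ^ 2) x :=
    fun x hx hx2 => (hasDerivAt_mul_besselJ_one x).fun_div (hasDerivAt_besselJ_zero x)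
      (hne x hx.le hx2)
  obtain ⟨x, hx, hslope⟩ := exists_hasDerivAt_eq_slope
    (fun x => x * besselJ 1 x / besselJ 0 x) _ hlt
    (fun y hy => (hder y (h0.trans_le hy.1) hy.2).continuousAt.continuousWithinAt)
    (fun y hy => hder y (h0.trans hy.1) hy.2.le)
  have hx0 := h0.trans hx.1
  have hJ := hne x hx0.le hx.2.le
  have hnum : Λ₂ * a * besselJ 1 (Λ₂ * a) / besselJ 0 (Λ₂ * a)
      - Λ₁ * a * besselJ 1 (Λ₁ * a) / besselJ 0 (Λ₁ * a) = 0 := by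
    linear_combination (-a) * hchar
  rw [hnum, zero_div] at hslope
  have hpos : 0 < (x * besselJ 0 x * besselJ 0 x - x * besselJ 1 x * -besselJ 1 x)
      / besselJ 0 x ^ 2 := by
    have : 0 < x * besselJ 0 x ^ 2 + x * besselJ 1 x ^ 2 := by positivity
    refine div_pos ?_ (by positivity)
    linarith
  exact hpos.ne' hslope

theorem IsFundamentalShift.coreGamma_pos {a n₀ lam δ β : ℝ} (hn : 0 < n₀) (hlam : 0 < lam)
    (h : IsFundamentalShift a n₀ lam δ β) : 0 < coreGamma n₀ lam β := by
  have := h.shift_pos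
  exact Real.sqrt_pos.2 (by positivity)

theorem IsFundamentalShift.integral_coreMode_mul_self {a n₀ lam δ β : ℝ} (ha : 0 < a) (hn : 0 < n₀)
    (hlam : 0 < lam) (h : IsFundamentalShift a n₀ lam δ β) (c : ℝ × ℝ) :
    ∫ p, coreMode a (coreLambda n₀ lam δ β) (coreGamma n₀ lam β) c p
      * coreMode a (coreLambda n₀ lam δ β) (coreGamma n₀ lam β) c p = 1 := by
  have hΛ : 0 < coreLambda n₀ lam δ β := Real.sqrt_pos.2 h.lambdaSq_pos
  exact WaveguideArray.integral_coreMode_mul_self ha hΛ.ne' (h.coreGamma_pos hn hlam)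
    (h.before_first_zero _ (by positivity) le_rfl) c

end WaveguideArray

/-! ### Assembly of the overlap matrix -/

open WaveguideArray in
theorem mainTheorem10 (P : Params) (hP : P.Admissible) :
    -- the overlap integrals converge absolutely, and the matrix is symmetric
    (∀ i j : Waveguide, Integrable (fun p : ℝ × ℝ => P.mode i p * P.mode j p)) ∧
    (∀ i j : Waveguide, P.S i j = P.S j i) ∧
    -- pairs of horizontal waveguides
    (∀ i : Set.Icc (-25 : ℤ) 25, P.S (.horiz i) (.horiz i) = 1) ∧
    (∀ i j : Set.Icc (-25 : ℤ) 25, i ≠ j →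
      ∀ d : ℝ, d = |((i : ℤ) : ℝ) - ((j : ℤ) : ℝ)| * P.Dh → 2 * P.a ≤ d →
      P.S (.horiz i) (.horiz j) =
        4 * P.a * Real.pi * P.A * P.B * besselK 0 (P.Γ * d) / (P.Γ ^ 2 + P.Λ ^ 2)
          * (P.Λ * besselI 0 (P.Γ * P.a) * besselJ 1 (P.Λ * P.a)
            + P.Γ * besselJ 0 (P.Λ * P.a) * besselI 1 (P.Γ * P.a))
        + Real.pi * P.B ^ 2 * d * besselK 1 (P.Γ * d) / P.Γ
        - 2 * Real.pi * P.B ^ 2 * P.a ^ 2 * besselK 0 (P.Γ * d)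
          * (besselI 0 (P.Γ * P.a) * besselK 0 (P.Γ * P.a)
            + besselI 1 (P.Γ * P.a) * besselK 1 (P.Γ * P.a))) ∧
    -- the two vertical waveguides with themselves
    P.S .plus .plus = 1 ∧
    P.S .minus .minus = 1 ∧
    -- horizontal and upper waveguide
    (∀ i : Set.Icc (-25 : ℤ) 25,
      ∀ d : ℝ, d = Real.sqrt ((((i : ℤ) : ℝ) * P.Dh) ^ 2 + P.Dv ^ 2) → 2 * P.a ≤ d →
      P.S (.horiz i) .plus =
        2 * Real.pi * P.Ap * P.B * besselK 0 (P.Γ * d) * (P.a / (P.Λp ^ 2 + P.Γ ^ 2))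
          * (P.Λp * besselI 0 (P.Γ * P.a) * besselJ 1 (P.Λp * P.a)
            + P.Γ * besselJ 0 (P.Λp * P.a) * besselI 1 (P.Γ * P.a))
        + 2 * Real.pi * P.A * P.Bp * besselK 0 (P.Γp * d) * (P.a / (P.Λ ^ 2 + P.Γp ^ 2))
          * (P.Λ * besselI 0 (P.Γp * P.a) * besselJ 1 (P.Λ * P.a)
            + P.Γp * besselJ 0 (P.Λ * P.a) * besselI 1 (P.Γp * P.a))
        + 2 * Real.pi * P.B * P.Bp * P.a / (P.Γp ^ 2 - P.Γ ^ 2)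
          * (besselK 0 (P.Γ * d)
              * (P.Γp * besselI 0 (P.Γ * P.a) * besselK 1 (P.Γp * P.a)
                + P.Γ * besselI 1 (P.Γ * P.a) * besselK 0 (P.Γp * P.a))
            - besselK 0 (P.Γp * d)
              * (P.Γ * besselI 0 (P.Γp * P.a) * besselK 1 (P.Γ * P.a)
                + P.Γp * besselI 1 (P.Γp * P.a) * besselK 0 (P.Γ * P.a)))) ∧
    -- horizontal and lower waveguide
    (∀ i : Set.Icc (-25 : ℤ) 25,
      ∀ d : ℝ, d = Real.sqrt ((((i : ℤ) : ℝ) * P.Dh) ^ 2 + P.Dv ^ 2) → 2 * P.a ≤ d →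
      P.S (.horiz i) .minus =
        2 * Real.pi * P.Am * P.B * besselK 0 (P.Γ * d) * (P.a / (P.Λm ^ 2 + P.Γ ^ 2))
          * (P.Λm * besselI 0 (P.Γ * P.a) * besselJ 1 (P.Λm * P.a)
            + P.Γ * besselJ 0 (P.Λm * P.a) * besselI 1 (P.Γ * P.a))
        + 2 * Real.pi * P.A * P.Bm * besselK 0 (P.Γm * d) * (P.a / (P.Λ ^ 2 + P.Γm ^ 2))
          * (P.Λ * besselI 0 (P.Γm * P.a) * besselJ 1 (P.Λ * P.a)
            + P.Γm * besselJ 0 (P.Λ * P.a) * besselI 1 (P.Γm * P.a))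
        + 2 * Real.pi * P.B * P.Bm * P.a / (P.Γ ^ 2 - P.Γm ^ 2)
          * (besselK 0 (P.Γm * d)
              * (P.Γ * besselI 0 (P.Γm * P.a) * besselK 1 (P.Γ * P.a)
                + P.Γm * besselI 1 (P.Γm * P.a) * besselK 0 (P.Γ * P.a))
            - besselK 0 (P.Γ * d)
              * (P.Γm * besselI 0 (P.Γ * P.a) * besselK 1 (P.Γm * P.a)
                + P.Γ * besselI 1 (P.Γ * P.a) * besselK 0 (P.Γm * P.a)))) ∧
    -- upper and lower waveguide; the denominators in the mixed formulas do not vanish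
    P.S .plus .minus =
        2 * Real.pi * P.Am * P.Bp * besselK 0 (P.Γp * (2 * P.Dv))
          * (P.a / (P.Λm ^ 2 + P.Γp ^ 2))
          * (P.Λm * besselI 0 (P.Γp * P.a) * besselJ 1 (P.Λm * P.a)
            + P.Γp * besselJ 0 (P.Λm * P.a) * besselI 1 (P.Γp * P.a))
        + 2 * Real.pi * P.Ap * P.Bm * besselK 0 (P.Γm * (2 * P.Dv))
          * (P.a / (P.Λp ^ 2 + P.Γm ^ 2))
          * (P.Λp * besselI 0 (P.Γm * P.a) * besselJ 1 (P.Λp * P.a)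
            + P.Γm * besselJ 0 (P.Λp * P.a) * besselI 1 (P.Γm * P.a))
        + 2 * Real.pi * P.Bp * P.Bm * P.a / (P.Γp ^ 2 - P.Γm ^ 2)
          * (besselK 0 (P.Γm * (2 * P.Dv))
              * (P.Γp * besselI 0 (P.Γm * P.a) * besselK 1 (P.Γp * P.a)
                + P.Γm * besselI 1 (P.Γm * P.a) * besselK 0 (P.Γp * P.a))
            - besselK 0 (P.Γp * (2 * P.Dv))
              * (P.Γm * besselI 0 (P.Γp * P.a) * besselK 1 (P.Γm * P.a)
                + P.Γp * besselI 1 (P.Γp * P.a) * besselK 0 (P.Γm * P.a))) ∧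
    P.Γp ^ 2 - P.Γ ^ 2 ≠ 0 ∧ P.Γ ^ 2 - P.Γm ^ 2 ≠ 0 ∧ P.Γp ^ 2 - P.Γm ^ 2 ≠ 0 := by
  have ha := hP.a_pos
  have hΓ : 0 < P.Γ := hP.fund.coreGamma_pos hP.n₀_pos hP.lam_pos
  have hΓp : 0 < P.Γp := hP.fund_plus.coreGamma_pos hP.n₀_pos hP.lam_pos
  have hΓm : 0 < P.Γm := hP.fund_minus.coreGamma_pos hP.n₀_pos hP.lam_pos
  have hε := hP.ε_pos
  have hp0 : P.Γp ^ 2 - P.Γ ^ 2 ≠ 0 := sub_ne_zero.2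
    (coreGamma_sq_ne ha hP.n₀_pos hP.lam_pos (by linarith) hP.fund hP.fund_plus).symm
  have h0m : P.Γ ^ 2 - P.Γm ^ 2 ≠ 0 := sub_ne_zero.2
    (coreGamma_sq_ne ha hP.n₀_pos hP.lam_pos (by linarith) hP.fund_minus hP.fund).symm
  have hpm : P.Γp ^ 2 - P.Γm ^ 2 ≠ 0 := sub_ne_zero.2
    (coreGamma_sq_ne ha hP.n₀_pos hP.lam_pos (by linarith) hP.fund_minus hP.fund_plus).symm
  have hsymm : ∀ i j : Waveguide, P.S i j = P.S j i := fun i j =>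
    integral_congr_ae (Filter.Eventually.of_forall fun p => mul_comm _ _)
  refine ⟨?_, hsymm, ?_, ?_, ?_, ?_, ?_, ?_, ?_, hp0, h0m, hpm⟩
  · rintro (_ | _ | _) (_ | _ | _) <;> exact integrable_coreMode_mul ha (by assumption)
      (by assumption) _ _
  · exact fun i => hP.fund.integral_coreMode_mul_self ha hP.n₀_pos hP.lam_pos _
  · rintro i j - d rfl hd
    refine overlap_of_eq ha hΓ ?_ hd
    have hDh : 0 < P.Dh := ha.trans hP.a_lt_Dh
    rw [euclDist, ← abs_of_pos hDh, ← abs_mul, abs_of_pos hDh, ← Real.sqrt_sq_eq_abs]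
    congr 1
    simp only
    ring
  · exact hP.fund_plus.integral_coreMode_mul_self ha hP.n₀_pos hP.lam_pos _
  · exact hP.fund_minus.integral_coreMode_mul_self ha hP.n₀_pos hP.lam_pos _
  · rintro i d rfl hd
    refine overlap_of_ne ha hΓ hΓp hp0 ?_ hd
    rw [euclDist]
    congr 1
    simp only
    ring
  · rintro i d rfl hd
    -- The lower core is taken first so that the denominator is `Γ² - Γ₋²`, as in the stated
    -- formula; the pair of vertical cores is treated alike.
    rw [hsymm]
    refine (overlap_of_ne ha hΓm hΓ h0m (c₁ := (0, -P.Dv)) (c₂ := ((i : ℤ) * P.Dh, 0))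
      ?_ hd).trans ?_
    · rw [euclDist]
      congr 1
      simp only
      ring
    · simp only [Params.A, Params.B, Params.Am, Params.Bm]
      ring
  · have hDv := hP.a_lt_Dv
    rw [hsymm]
    -- The vertical cores are automatically disjoint, since `a < D_v` gives `2a ≤ 2D_v`.
    refine (overlap_of_ne ha hΓm hΓp hpm (c₁ := (0, -P.Dv)) (c₂ := (0, P.Dv)) (d := 2 * P.Dv)
      ?_ (by linarith)).trans ?_
    · have hDv0 : 0 ≤ 2 * P.Dv := by linarith
      rw [euclDist, ← Real.sqrt_sq hDv0]
      congr 1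
      simp only
      ring
    · simp only [Params.Ap, Params.Bp, Params.Am, Params.Bm]
      ring
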